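/- Let $K$ be a compact connected semisimple Lie group with Lie algebra $\mathfrak k$, let $n\ge 3$, and put $\mathfrak g=\mathfrak k^n$, $H=\{(g,\dots,g)\mid g\in K\}\subset K^n$ and $$\mathfrak v=\{x=(x_1,\dots,x_n)\in\mathfrak k^n \mid x_1+\dots+x_n=0\},$$ on which $H$ acts by $\mathrm{Ad}_{(g,\dots,g)}(x_1,\dots,x_n)=(\mathrm{Ad}_g x_1,\dots,\mathrm{Ad}_g x_n)$. Let $\langle\cdot,\cdot\rangle$ be the negative Killing form of $\mathfrak g$, that is $\langle x,y\rangle=\sum_{i}\langle x_i,y_i\rangle$ with the negative Killing form of $\mathfrak k$ in each factor, and let $\nabla$ be the gradient of functions on $\mathfrak v$ with respect to its restriction to $\mathfrak v$. Let $\mathbb R[\mathfrak v]^H$ be the algebra of $\mathrm{Ad}_H$-invariant real polynomials on $\mathfrak v$. For $x\in\mathfrak v$ let $\mathfrak j_x\subset\mathfrak v$ be the linear span of the gradients $\nabla f(x)$, $f\in\mathbb R[\mathfrak v]^H$, and let $\bar\Lambda_x$ be the restriction to $\mathfrak j_x$ of the Lie-Poisson bivector $$\Lambda_x(\eta,\zeta)=-\langle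 x,[\eta,\zeta]\rangle=-\sum_{i=1}^n\langle x_i,[\eta_i,\zeta_i]\rangle .$$ Then $\dim\mathfrak j_x$ and $\dim\ker\bar\Lambda_x$ are constant almost everywhere on $\mathfrak v$ (on an open set whose complement has Lebesgue measure zero), and these constants, the differential dimension and the differential index of $\mathbb R[\mathfrak v]^H$, are $$\mathrm{ddim}\,\mathbb R[\mathfrak v]^H=(n-2)\dim K,\qquad \mathrm{dind}\,\mathbb R[\mathfrak v]^H=n\,\mathrm{rank}\,K,$$ where $\mathrm{rank}\,K$ is the rank of the Lie algebra $\mathfrak k$, i.e. the smallest multiplicity of the eigenvalue $0$ of $\mathrm{ad}_\xi$, $\xi\in\mathfrak k$ (equivalently, the dimension of a maximal torus of $K$). -/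

import Mathlib

open scoped Manifold ContDiff

noncomputable section

namespace LedgerObata

/-! ### Functions on a finite-dimensional real vector space -/

section VectorSpace

variable (V : Type*) [AddCommGroup V] [Module ℝ V]

/-- The algebra `ℝ[V]` of real polynomial functions on `V`: the algebra of functions generated by
the constants and the linear functionals. -/
def polynomialAlgebra : Subalgebra ℝ (V → ℝ) :=
  Algebra.adjoin ℝ {f | ∃ φ : Module.Dual ℝ V, f = fun x => φ x}

variable {V}

/-- `P` holds almost everywhere on `V`: on an open set whose complement has Lebesgue measure zero
(in linear coordinates on `V`; openness and nullity do not depend on the coordinates). Such an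
open set is automatically dense. -/
def AlmostEverywhere [Module.Finite ℝ V] (P : V → Prop) : Prop :=
  ∃ U : Set (Fin (Module.finrank ℝ V) → ℝ), IsOpen U ∧ MeasureTheory.volume Uᶜ = 0 ∧
    ∀ y ∈ U, P ((Module.finBasis ℝ V).equivFun.symm y)

/-- `η` is the gradient at `x` of `f : V → ℝ` with respect to the form `B`: the differential of `f`
at `x` is `w ↦ B η w`. -/
def IsGradientAt (B : LinearMap.BilinForm ℝ V) (f : V → ℝ) (x η : V) : Prop :=
  ∀ w : V, HasLineDerivAt ℝ f (B η w) x w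

/-- The linear span of the gradients at `x` of the functions in `F`. -/
def gradientSpan (B : LinearMap.BilinForm ℝ V) (F : Set (V → ℝ)) (x : V) : Submodule ℝ V :=
  Submodule.span ℝ {η | ∃ f ∈ F, IsGradientAt B f x η}

/-- `F` has differential dimension `m`. Differentials are identified with gradients through the
nondegenerate form `B`. -/
def HasDifferentialDimension [Module.Finite ℝ V] (B : LinearMap.BilinForm ℝ V)
    (F : Set (V → ℝ)) (m : ℕ) : Prop :=
  AlmostEverywhere fun x : V => Module.finrank ℝ (gradientSpan B F x) = m

/-- `F` has differential index `m` with respect to the bivector field `Λ`: almost everywhere the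
kernel of the restriction of `Λ x` to the span of the differentials has dimension `m`. -/
def HasDifferentialIndex [Module.Finite ℝ V] (B : LinearMap.BilinForm ℝ V)
    (Λ : V → LinearMap.BilinForm ℝ V) (F : Set (V → ℝ)) (m : ℕ) : Prop :=
  AlmostEverywhere fun x : V =>
    Module.finrank ℝ (LinearMap.ker ((Λ x).restrict (gradientSpan B F x))) = m

end VectorSpace

/-! ### The space `𝔳 ⊆ 𝔤 = 𝔨ⁿ` -/

section LieAlgebra

variable (n : ℕ) (L : Type*) [LieRing L] [LieAlgebra ℝ L]

/-- `𝔳 = {(x₁, …, xₙ) ∈ 𝔨ⁿ | x₁ + ⋯ + xₙ = 0}`. -/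
def vSpace : Submodule ℝ (Fin n → L) where
  carrier := {x | ∑ i, x i = 0}
  zero_mem' := by simp
  add_mem' := by
    intro x y hx hy
    simp only [Set.mem_ofPred_eq] at hx hy ⊢
    simp [Finset.sum_add_distrib, hx, hy]
  smul_mem' := by
    intro c x hx
    simp only [Set.mem_ofPred_eq] at hx ⊢
    simp [← Finset.smul_sum, hx]

/-- The restriction to `𝔳` of the negative Killing form of `𝔤 = 𝔨ⁿ`, which is the sum of the
negative Killing forms of the factors: `⟨x, y⟩ = ∑ᵢ ⟨xᵢ, yᵢ⟩`. -/
def vForm : LinearMap.BilinForm ℝ (vSpace n L) :=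
  LinearMap.mk₂ ℝ (fun x y => ∑ i, (-killingForm ℝ L) (x.1 i) (y.1 i))
    (by intros; simp [Finset.sum_add_distrib, add_comm])
    (by intros; simp [Finset.mul_sum])
    (by intros; simp [Finset.sum_add_distrib, add_comm])
    (by intros; simp [Finset.mul_sum])

/-- The Lie-Poisson bivector of `𝔤 = 𝔨ⁿ` at `x ∈ 𝔳`, restricted to `𝔳`:
`(η, ζ) ↦ -⟨x, [η, ζ]⟩ = -∑ᵢ ⟨xᵢ, [ηᵢ, ζᵢ]⟩`, with `⟨·, ·⟩` the negative Killing form. -/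
def vBivector (x : vSpace n L) : LinearMap.BilinForm ℝ (vSpace n L) :=
  LinearMap.mk₂ ℝ (fun η ζ => -∑ i, (-killingForm ℝ L) (x.1 i) ⁅η.1 i, ζ.1 i⁆)
    (by intros; simp [Finset.sum_add_distrib])
    (by intros; simp [Finset.mul_sum])
    (by intros; simp [Finset.sum_add_distrib])
    (by intros; simp [Finset.mul_sum])

end LieAlgebra

/-! ### The Lie group `K` and the invariant polynomials -/

section LieGroup

/-- A smooth real Lie group has the smoothness required for the Lie algebra structure on its
tangent space at the identity. -/
instance lieGroup_minSmoothness {d : ℕ} {K : Type*} [TopologicalSpace K]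
    [ChartedSpace (EuclideanSpace ℝ (Fin d)) K] [Group K] [LieGroup (𝓡 d) ∞ K] :
    LieGroup (𝓡 d) (minSmoothness ℝ 3) K := by
  rw [minSmoothness_of_isRCLikeNormedField]
  infer_instance

instance finite_groupLieAlgebra {d : ℕ} {K : Type*} [TopologicalSpace K]
    [ChartedSpace (EuclideanSpace ℝ (Fin d)) K] [Group K] :
    Module.Finite ℝ (GroupLieAlgebra (𝓡 d) K) :=
  inferInstanceAs (Module.Finite ℝ (EuclideanSpace ℝ (Fin d)))

variable {d : ℕ} {K : Type*} [TopologicalSpace K]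
  [ChartedSpace (EuclideanSpace ℝ (Fin d)) K] [Group K]

/-- The adjoint action `Ad_k : 𝔨 → 𝔨`, the differential at the identity of the conjugation
`g ↦ k g k⁻¹`. -/
def Ad (k : K) : GroupLieAlgebra (𝓡 d) K →ₗ[ℝ] GroupLieAlgebra (𝓡 d) K :=
  (mfderiv (𝓡 d) (𝓡 d) (fun g : K => k * g * k⁻¹) (1 : K)).toLinearMap

variable [LieGroup (𝓡 d) ∞ K]

/-- The action on `𝔳` of the element `(k, …, k)` of `H = diag(K)`:
`(x₁, …, xₙ) ↦ (Ad_k x₁, …, Ad_k xₙ)`. -/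
def AdH (n : ℕ) (k : K) (x : vSpace n (GroupLieAlgebra (𝓡 d) K)) :
    vSpace n (GroupLieAlgebra (𝓡 d) K) :=
  ⟨fun i => Ad k (x.1 i), by
    have h : ∑ i, x.1 i = 0 := x.2
    change ∑ i, Ad k (x.1 i) = 0
    rw [← map_sum, h, map_zero]⟩

variable (d K) in
/-- The algebra `ℝ[𝔳]^H` of `Ad_H`-invariant polynomials on `𝔳`. -/
def invariantPolynomials (n : ℕ) :
    Subalgebra ℝ (vSpace n (GroupLieAlgebra (𝓡 d) K) → ℝ) where
  carrier := {f | f ∈ polynomialAlgebra (vSpace n (GroupLieAlgebra (𝓡 d) K)) ∧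
    ∀ (k : K) (x : vSpace n (GroupLieAlgebra (𝓡 d) K)), f (AdH n k x) = f x}
  mul_mem' := by
    rintro f g ⟨hf, hf'⟩ ⟨hg, hg'⟩
    exact ⟨mul_mem hf hg, fun k x => by simp [hf', hg']⟩
  add_mem' := by
    rintro f g ⟨hf, hf'⟩ ⟨hg, hg'⟩
    exact ⟨add_mem hf hg, fun k x => by simp [hf', hg']⟩
  algebraMap_mem' := fun r => ⟨Subalgebra.algebraMap_mem _ r, fun k x => rfl⟩

end LieGroup

end LedgerObata

end

/-! Put `L = 𝔨`, `κ` its Killing form, and let `T` be the tangent space at `x` to its orbit, i.e.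
the tuples `([ξ, xᵢ])`. Suppose the entries of `x` generate `L`. An element commuting with all of
them is central, hence zero, so `dim T = dim L`.

Gradients of invariants are orthogonal to `T`. Conversely, the invariants `κ(a(x), b(x))`, for
iterated brackets `a`, `b`, already have enough gradients. If `y` is orthogonal to all of these,
moving `x` in the direction `y` preserves every such product to first order. By nondegeneracy of
`κ`, sending each word to its first variation then gives a well-defined derivation of `L`.
Derivations are inner, so `y ∈ T` (`exists_eq_lie_of_killingForm_lieWordDeriv`). Hence `𝔧ₓ = T^⊥`,
of dimension `(n - 1) dim L - dim L` (`gradientSpan_eq_orthogonal`).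

By invariance of `κ`, a vector `η ∈ T^⊥` is in the kernel iff `([xᵢ, ηᵢ])` lies in `T`, that is, iff
for some `ξ` every `ηᵢ + ξ` centralizes `xᵢ`. As `∑ ηᵢ = 0`, `ξ` is the mean of the `ηᵢ + ξ`, so the
kernel is the injective image of the product of the centralizers of the `xᵢ`
(`map_ker_restrict_vBivector`). Each has dimension `rank L` when `xᵢ` is regular.

Generation and regularity hold off the zero set of a nonzero polynomial
(`exists_polynomial_generic`): two elements generate `L`, and for `n ≥ 3` two entries of a tuple in
`𝔳` can be chosen freely. The group enters only through two facts: `Ad` acts by Lie algebra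
automorphisms, and its derivative at the identity is the bracket. -/

noncomputable section

namespace LedgerObata

/-! ### Polynomial functions -/

section PolynomialFunctions

open MeasureTheory

/-- The zero set of a nonzero real polynomial in finitely many variables is Lebesgue-null. -/
theorem volume_zeros_mvPolynomial_eq_zero : ∀ {m : ℕ} {p : MvPolynomial (Fin m) ℝ}, p ≠ 0 →
    volume {y : Fin m → ℝ | MvPolynomial.eval y p = 0} = 0
  | 0, p, hp => by
    have : {y : Fin 0 → ℝ | MvPolynomial.eval y p = 0} = ∅ := by
      ext y
      simp only [Set.mem_ofPred_eq, Set.mem_empty_iff_false, iff_false]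
      intro hy
      apply hp
      apply MvPolynomial.funext
      intro z
      rw [Subsingleton.elim z y, hy, map_zero]
    rw [this, measure_empty]
  | m + 1, p, hp => by
    set P := MvPolynomial.finSuccEquiv ℝ m p with hP
    have hP0 : P ≠ 0 := by simpa [hP] using hp
    have hlead := volume_zeros_mvPolynomial_eq_zero (Polynomial.leadingCoeff_ne_zero.2 hP0)
    have hcont : Continuous fun y : Fin (m + 1) → ℝ => MvPolynomial.eval y p :=
      MvPolynomial.continuous_eval p
    have hmeas : MeasurableSet {y : Fin (m + 1) → ℝ | MvPolynomial.eval y p = 0} :=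
      (isClosed_eq hcont continuous_const).measurableSet
    -- Fubini, with the last `m` variables outside: for almost every value of these the leading
    -- coefficient in the first variable survives, so the slice is a finite set of roots.
    have hpres := (volume_preserving_piFinSuccAbove (fun _ : Fin (m + 1) => ℝ) 0).symm.comp
      (Measure.measurePreserving_swap (μ := (volume : Measure (Fin m → ℝ)))
        (ν := (volume : Measure ℝ)))
    rw [← hpres.measure_preimage hmeas.nullMeasurableSet]
    refine Measure.measure_prod_null_of_ae_null (hpres.measurable hmeas) ?_
    have hae : ∀ᵐ z : Fin m → ℝ, MvPolynomial.eval z P.leadingCoeff ≠ 0 := by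
      rw [ae_iff]
      simpa using hlead
    filter_upwards [hae] with z hz
    have hQ : P.map (MvPolynomial.eval z) ≠ 0 := fun h0 => hz <| by
      simpa using congrArg (fun Q => Polynomial.coeff Q P.natDegree) h0
    refine Set.Finite.measure_zero (Set.Finite.subset
      (Polynomial.finite_setOfPred_isRoot hQ) fun t ht => ?_) _
    have ht' : MvPolynomial.eval (Fin.cons t z : Fin (m + 1) → ℝ) p = 0 := by
      simpa [Fin.insertNthEquiv, Fin.insertNth_zero'] using ht
    rw [MvPolynomial.eval_eq_eval_mv_eval'] at ht'
    exact ht'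

variable {V : Type*} [AddCommGroup V] [Module ℝ V]

theorem exists_mvPolynomial_of_mem_polynomialAlgebra {ι : Type*} [Fintype ι]
    (b : Module.Basis ι ℝ V) {f : V → ℝ}
    (hf : f ∈ polynomialAlgebra V) :
    ∃ p : MvPolynomial ι ℝ, ∀ y, MvPolynomial.eval y p = f (b.equivFun.symm y) := by
  induction hf using Algebra.adjoin_induction with
  | mem f hf =>
    obtain ⟨φ, rfl⟩ := hf
    refine ⟨∑ i, MvPolynomial.C (φ (b i)) * MvPolynomial.X i, fun y => ?_⟩
    simp [Module.Basis.equivFun_symm_apply, mul_comm]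
  | algebraMap r => exact ⟨MvPolynomial.C r, fun y => by simp⟩
  | add f g _ _ hf hg =>
    obtain ⟨p, hp⟩ := hf
    obtain ⟨q, hq⟩ := hg
    exact ⟨p + q, fun y => by simp [hp, hq]⟩
  | mul f g _ _ hf hg =>
    obtain ⟨p, hp⟩ := hf
    obtain ⟨q, hq⟩ := hg
    exact ⟨p * q, fun y => by simp [hp, hq]⟩

/-- A property that holds outside the zero set of a nonzero polynomial function holds almost
everywhere. -/
theorem almostEverywhere_of_polynomial [Module.Finite ℝ V] {P : V → Prop} {f : V → ℝ}
    (hf : f ∈ polynomialAlgebra V) (hf0 : f ≠ 0) (hP : ∀ x, f x ≠ 0 → P x) :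
    AlmostEverywhere P := by
  obtain ⟨p, hp⟩ := exists_mvPolynomial_of_mem_polynomialAlgebra (Module.finBasis ℝ V) hf
  have hp0 : p ≠ 0 := by
    rintro rfl
    apply hf0
    ext x
    simpa using (hp ((Module.finBasis ℝ V).equivFun x)).symm
  refine ⟨{y | MvPolynomial.eval y p ≠ 0}, ?_, ?_, fun y hy => hP _ ?_⟩
  · exact isOpen_ne_fun (MvPolynomial.continuous_eval p) continuous_const
  · have : {y | MvPolynomial.eval y p ≠ 0}ᶜ = {y | MvPolynomial.eval y p = 0} := by
      ext y; simp
    rw [this]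
    exact volume_zeros_mvPolynomial_eq_zero hp0
  · rw [← hp]; exact hy

/-- In coordinates a polynomial function vanishes iff its polynomial does, `ℝ` being infinite, and
`MvPolynomial` over a field is a domain. -/
theorem mul_ne_zero_of_mem_polynomialAlgebra [Module.Finite ℝ V] {f g : V → ℝ}
    (hf : f ∈ polynomialAlgebra V) (hg : g ∈ polynomialAlgebra V) (hf0 : f ≠ 0)
    (hg0 : g ≠ 0) : f * g ≠ 0 := by
  set b := Module.finBasis ℝ V
  obtain ⟨p, hp⟩ := exists_mvPolynomial_of_mem_polynomialAlgebra b hf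
  obtain ⟨q, hq⟩ := exists_mvPolynomial_of_mem_polynomialAlgebra b hg
  have key : ∀ {h : V → ℝ} {r : MvPolynomial _ ℝ},
      (∀ y, MvPolynomial.eval y r = h (b.equivFun.symm y)) → (r = 0 ↔ h = 0) := by
    intro h r hr
    constructor
    · rintro rfl
      ext x
      simpa using (hr (b.equivFun x)).symm
    · rintro rfl
      exact MvPolynomial.funext fun y => by simp [hr]
  have hpq : ∀ y, MvPolynomial.eval y (p * q) = (f * g) (b.equivFun.symm y) := fun y => by
    simp [hp, hq]
  rw [Ne, ← key hpq]
  exact mul_ne_zero ((key hp).not.2 hf0) ((key hq).not.2 hg0)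

theorem prod_ne_zero_of_mem_polynomialAlgebra [Module.Finite ℝ V] {ι : Type*} (s : Finset ι)
    {f : ι → V → ℝ} (hf : ∀ i ∈ s, f i ∈ polynomialAlgebra V) (hf0 : ∀ i ∈ s, f i ≠ 0) :
    ∏ i ∈ s, f i ≠ 0 := by
  classical
  induction s using Finset.induction_on with
  | empty => simp
  | insert a s ha ih =>
    rw [Finset.prod_insert ha]
    exact mul_ne_zero_of_mem_polynomialAlgebra (hf a (by simp))
      (prod_mem fun i hi => hf i (by simp [hi])) (hf0 a (by simp))
      (ih (fun i hi => hf i (by simp [hi])) fun i hi => hf0 i (by simp [hi]))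

end PolynomialFunctions

/-! ### Differentiating conjugations -/

section Calculus

open Filter Topology

variable {E : Type*} [NormedAddCommGroup E] [NormedSpace ℝ E]

theorem fderiv_partial_snd {M : E × E → E} {a b : E} (hM : DifferentiableAt ℝ M (a, b)) :
    fderiv ℝ (fun y => M (a, y)) b = (fderiv ℝ M (a, b)).comp (ContinuousLinearMap.inr ℝ E E) :=
  (hM.hasFDerivAt.comp b (hasFDerivAt_prodMk_right a b)).fderiv

/-- If, in a chart, `M` is a local multiplication with unit `e` and `C (a, b)` is the conjugate of
`b` by `a`, then the derivative at `e` of the adjoint action is the commutator of the second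
derivatives of `M`. -/
theorem hasFDerivAt_fderiv_conj {M C : E × E → E} {e : E}
    (hM : ContDiffAt ℝ 2 M (e, e)) (hC : ContDiffAt ℝ 2 C (e, e))
    (hMC : ∀ᶠ p in 𝓝 (e, e), M (C p, p.1) = M p)
    (hMr : ∀ᶠ a in 𝓝 e, M (a, e) = a)
    (hCe : ∀ᶠ a in 𝓝 e, C (a, e) = e) (hCb : ∀ᶠ b in 𝓝 e, C (e, b) = b) (w : E) :
    ∃ D : E →L[ℝ] E, HasFDerivAt (fun a => fderiv ℝ (fun b => C (a, b)) e w) D e ∧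
      ∀ v, D v = fderiv ℝ (fun a => fderiv ℝ (fun b => M (a, b)) e w) e v -
        fderiv ℝ (fun a => fderiv ℝ (fun b => M (a, b)) e v) e w := by
  have two : (2 : WithTop ℕ∞) ≠ 0 := by norm_num
  have hin : Tendsto (fun a : E => (a, e)) (𝓝 e) (𝓝 (e, e)) := by
    have : Continuous fun a : E => (a, e) := by fun_prop
    exact this.tendsto e
  have hin' : Tendsto (fun a : E => (e, a)) (𝓝 e) (𝓝 (e, e)) := by
    have : Continuous fun a : E => (e, a) := by fun_prop
    exact this.tendsto e
  have evM : ∀ᶠ p in 𝓝 (e, e), DifferentiableAt ℝ M p :=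
    (hM.eventually (by simp)).mono fun p hp => hp.differentiableAt two
  have evC : ∀ᶠ p in 𝓝 (e, e), DifferentiableAt ℝ C p :=
    (hC.eventually (by simp)).mono fun p hp => hp.differentiableAt two
  have hM' : DifferentiableAt ℝ (fderiv ℝ M) (e, e) :=
    (hM.fderiv_right (m := 1) (by norm_num)).differentiableAt (by norm_num)
  have hC' : DifferentiableAt ℝ (fderiv ℝ C) (e, e) :=
    (hC.fderiv_right (m := 1) (by norm_num)).differentiableAt (by norm_num)
  have hl : HasFDerivAt (fun a : E => (a, e)) (ContinuousLinearMap.inl ℝ E E) e :=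
    hasFDerivAt_prodMk_left e e
  have hr : HasFDerivAt (fun a : E => (e, a)) (ContinuousLinearMap.inr ℝ E E) e :=
    hasFDerivAt_prodMk_right e e
  set M2 := fderiv ℝ (fderiv ℝ M) (e, e) with hM2
  -- the left-invariant vector field
  have hL : ∀ u : E, HasFDerivAt (fun a => fderiv ℝ (fun b => M (a, b)) e u)
      ((ContinuousLinearMap.apply ℝ E ((0 : E), u)).comp
        (M2.comp (ContinuousLinearMap.inl ℝ E E))) e := by
    intro u
    have h1 := (ContinuousLinearMap.apply ℝ E ((0 : E), u)).hasFDerivAt.comp e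
      (HasFDerivAt.comp (f := fun a : E => (a, e)) e hM'.hasFDerivAt hl)
    refine h1.congr_of_eventuallyEq ?_
    filter_upwards [hin.eventually evM] with a ha
    rw [fderiv_partial_snd ha]
    simp
  -- the adjoint action
  have hA : HasFDerivAt (fun a => fderiv ℝ (fun b => C (a, b)) e w)
      ((ContinuousLinearMap.apply ℝ E ((0 : E), w)).comp
        ((fderiv ℝ (fderiv ℝ C) (e, e)).comp (ContinuousLinearMap.inl ℝ E E))) e := by
    have h1 := (ContinuousLinearMap.apply ℝ E ((0 : E), w)).hasFDerivAt.comp e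
      (HasFDerivAt.comp (f := fun a : E => (a, e)) e hC'.hasFDerivAt hl)
    refine h1.congr_of_eventuallyEq ?_
    filter_upwards [hin.eventually evC] with a ha
    rw [fderiv_partial_snd ha]
    simp
  set D := ((ContinuousLinearMap.apply ℝ E ((0 : E), w)).comp
        ((fderiv ℝ (fderiv ℝ C) (e, e)).comp (ContinuousLinearMap.inl ℝ E E)))
  refine ⟨D, hA, fun v => ?_⟩
  have hAe : fderiv ℝ (fun b => C (e, b)) e w = w := by
    have : (fun b => C (e, b)) =ᶠ[𝓝 e] id := hCb
    rw [this.fderiv_eq, fderiv_id]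
    rfl
  have hMe : ∀ u : E, fderiv ℝ M (e, e) (u, 0) = u := by
    intro u
    have h1 : HasFDerivAt (fun a => M (a, e)) _ e :=
      HasFDerivAt.comp e (evM.self_of_nhds).hasFDerivAt hl
    have h2 : HasFDerivAt (fun a => M (a, e)) (ContinuousLinearMap.id ℝ E) e :=
      (hasFDerivAt_id e).congr_of_eventuallyEq hMr
    simpa using congrArg (fun T : E →L[ℝ] E => T u) (h1.unique h2)
  -- the identity `(a b a⁻¹) a = a b`, differentiated in `b`
  have hid : ∀ᶠ a in 𝓝 e, fderiv ℝ M (e, a) (fderiv ℝ (fun b => C (a, b)) e w, 0) =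
      fderiv ℝ (fun b => M (a, b)) e w := by
    filter_upwards [hin.eventually evC, hin'.eventually evM,
      hin.eventually hMC.eventually_nhds, hCe] with a haC haM haMC haCe
    have h1 : (fun b => M (a, b)) =ᶠ[𝓝 e] fun b => M (C (a, b), a) := by
      have ht : Tendsto (fun b : E => (a, b)) (𝓝 e) (𝓝 (a, e)) := by
        have : Continuous fun b : E => (a, b) := by fun_prop
        exact this.tendsto e
      filter_upwards [ht.eventually haMC] with b hb using hb.symm
    have hCd : DifferentiableAt ℝ (fun b => C (a, b)) e :=
      haC.comp e (hasFDerivAt_prodMk_right a e).differentiableAt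
    have h2 : HasFDerivAt (fun b => (C (a, b), a)) _ e :=
      hCd.hasFDerivAt.prodMk (hasFDerivAt_const a e)
    have h3 : HasFDerivAt M (fderiv ℝ M (e, a)) (C (a, e), a) := by
      rw [haCe]; exact haM.hasFDerivAt
    have h4 := HasFDerivAt.comp e h3 h2
    rw [h1.fderiv_eq]
    have h5 := h4.fderiv
    have : fderiv ℝ (fun b => M (C (a, b), a)) e = _ := h5
    rw [this]
    simp
  -- Differentiating `hid` at `a = e` in the direction `v` gives `M2 (0, v) (w, 0) + D v = M2 (v, 0)
  -- (0, w)`; symmetry of `M2` turns its first term into the derivative of the left-invariant field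
  -- of `v` along `w`.
  have h1 : HasFDerivAt (fun a => fderiv ℝ M (e, a)) _ e := HasFDerivAt.comp e hM'.hasFDerivAt hr
  have h2 : HasFDerivAt (fun a => (fderiv ℝ (fun b => C (a, b)) e w, (0 : E))) _ e :=
    hA.prodMk (hasFDerivAt_const 0 e)
  have h3 := h1.clm_apply h2
  have h4 := h3.unique ((hL w).congr_of_eventuallyEq hid)
  have h5 := congrArg (fun T : E →L[ℝ] E => T v) h4
  simp only [add_apply, ContinuousLinearMap.comp_apply,
    ContinuousLinearMap.prod_apply, zero_apply, hMe,
    ContinuousLinearMap.flip_apply, ContinuousLinearMap.inl_apply, ContinuousLinearMap.inr_apply,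
    ContinuousLinearMap.apply_apply, hAe] at h5
  have hsymm : M2 (0, v) (w, 0) = M2 (w, 0) (0, v) :=
    (hM.isSymmSndFDerivAt (by simp [minSmoothness_of_isRCLikeNormedField])).eq _ _
  rw [(hL w).fderiv, (hL v).fderiv]
  simp only [ContinuousLinearMap.comp_apply, ContinuousLinearMap.inl_apply,
    ContinuousLinearMap.apply_apply]
  rw [← h5, hsymm]
  abel

end Calculus

/-! ### The adjoint representation -/

section Group

open Filter Topology VectorField

variable {d : ℕ} {K : Type*} [TopologicalSpace K]
  [ChartedSpace (EuclideanSpace ℝ (Fin d)) K] [Group K]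

variable (d K) in
/-- The preferred chart at the identity. -/
abbrev chartOne : PartialEquiv K (EuclideanSpace ℝ (Fin d)) := extChartAt (𝓡 d) (1 : K)

variable (d K) in
/-- The coordinates of the identity. -/
abbrev coordOne : EuclideanSpace ℝ (Fin d) := chartOne d K 1

/-- Multiplication, read in the chart at the identity. -/
def mulChart (p : EuclideanSpace ℝ (Fin d) × EuclideanSpace ℝ (Fin d)) :
    EuclideanSpace ℝ (Fin d) :=
  chartOne d K ((chartOne d K).symm p.1 * (chartOne d K).symm p.2)

/-- Conjugation by `k`, read in the chart at the identity. -/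
def conjChart (k : K) (b : EuclideanSpace ℝ (Fin d)) : EuclideanSpace ℝ (Fin d) :=
  chartOne d K (k * (chartOne d K).symm b * k⁻¹)

theorem chartOne_symm_coordOne : (chartOne d K).symm (coordOne d K) = 1 :=
  extChartAt_to_inv (1 : K)

theorem conjChart_coordOne (k : K) : conjChart k (coordOne d K) = coordOne d K := by
  rw [conjChart, chartOne_symm_coordOne, mul_one, mul_inv_cancel]

theorem eventually_chartOne_right_inv :
    ∀ᶠ a in 𝓝 (coordOne d K), chartOne d K ((chartOne d K).symm a) = a := by
  filter_upwards [extChartAt_target_mem_nhds (I := 𝓡 d) (1 : K)] with a ha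
  exact (chartOne d K).right_inv ha

theorem eventually_chartOne_left_inv :
    ∀ᶠ g in 𝓝 (1 : K), (chartOne d K).symm (chartOne d K g) = g := by
  filter_upwards [extChartAt_source_mem_nhds (I := 𝓡 d) (1 : K)] with a ha
  exact (chartOne d K).left_inv ha

variable [LieGroup (𝓡 d) ∞ K]

theorem contMDiffAt_chartOne_symm :
    ContMDiffAt 𝓘(ℝ, EuclideanSpace ℝ (Fin d)) (𝓡 d) ∞ (chartOne d K).symm (coordOne d K) :=
  (contMDiffOn_extChartAt_symm (1 : K)).contMDiffAt (extChartAt_target_mem_nhds (1 : K))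

theorem tendsto_chartOne_symm : Tendsto (chartOne d K).symm (𝓝 (coordOne d K)) (𝓝 1) := by
  have := (contMDiffAt_chartOne_symm (d := d) (K := K)).continuousAt.tendsto
  rwa [chartOne_symm_coordOne] at this

theorem contDiffAt_conjChart_uncurry :
    ContDiffAt ℝ 2 (fun p : EuclideanSpace ℝ (Fin d) × EuclideanSpace ℝ (Fin d) =>
      conjChart ((chartOne d K).symm p.1) p.2) (coordOne d K, coordOne d K) := by
  have h1 : ContMDiffAt 𝓘(ℝ, EuclideanSpace ℝ (Fin d) × EuclideanSpace ℝ (Fin d)) (𝓡 d) ∞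
      (fun p : EuclideanSpace ℝ (Fin d) × EuclideanSpace ℝ (Fin d) => (chartOne d K).symm p.1)
      (coordOne d K, coordOne d K) :=
    contMDiffAt_chartOne_symm.comp (coordOne d K, coordOne d K) contDiff_fst.contMDiff.contMDiffAt
  have h2 : ContMDiffAt 𝓘(ℝ, EuclideanSpace ℝ (Fin d) × EuclideanSpace ℝ (Fin d)) (𝓡 d) ∞
      (fun p : EuclideanSpace ℝ (Fin d) × EuclideanSpace ℝ (Fin d) => (chartOne d K).symm p.2)
      (coordOne d K, coordOne d K) :=
    contMDiffAt_chartOne_symm.comp (coordOne d K, coordOne d K) contDiff_snd.contMDiff.contMDiffAt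
  have h3 := (h1.mul h2).mul h1.inv
  have h4 : ContMDiffAt (𝓡 d) 𝓘(ℝ, EuclideanSpace ℝ (Fin d)) ∞ (chartOne d K)
      ((chartOne d K).symm (coordOne d K) * (chartOne d K).symm (coordOne d K) *
        ((chartOne d K).symm (coordOne d K))⁻¹) := by
    rw [chartOne_symm_coordOne, mul_one, one_mul, inv_one]
    exact contMDiffAt_extChartAt
  have h5 := (h4.comp (coordOne d K, coordOne d K) h3).contDiffAt
  exact h5.of_le ENat.LEInfty.out

theorem contDiffAt_mulChart :
    ContDiffAt ℝ 2 (mulChart (d := d) (K := K)) (coordOne d K, coordOne d K) := by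
  have h1 : ContMDiffAt 𝓘(ℝ, EuclideanSpace ℝ (Fin d) × EuclideanSpace ℝ (Fin d)) (𝓡 d) ∞
      (fun p : EuclideanSpace ℝ (Fin d) × EuclideanSpace ℝ (Fin d) => (chartOne d K).symm p.1)
      (coordOne d K, coordOne d K) :=
    contMDiffAt_chartOne_symm.comp (coordOne d K, coordOne d K) contDiff_fst.contMDiff.contMDiffAt
  have h2 : ContMDiffAt 𝓘(ℝ, EuclideanSpace ℝ (Fin d) × EuclideanSpace ℝ (Fin d)) (𝓡 d) ∞
      (fun p : EuclideanSpace ℝ (Fin d) × EuclideanSpace ℝ (Fin d) => (chartOne d K).symm p.2)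
      (coordOne d K, coordOne d K) :=
    contMDiffAt_chartOne_symm.comp (coordOne d K, coordOne d K) contDiff_snd.contMDiff.contMDiffAt
  have h3 := h1.mul h2
  have h4 : ContMDiffAt (𝓡 d) 𝓘(ℝ, EuclideanSpace ℝ (Fin d)) ∞ (chartOne d K)
      ((chartOne d K).symm (coordOne d K) * (chartOne d K).symm (coordOne d K)) := by
    rw [chartOne_symm_coordOne, mul_one]
    exact contMDiffAt_extChartAt
  have h5 := (h4.comp (coordOne d K, coordOne d K) h3).contDiffAt
  exact h5.of_le ENat.LEInfty.out

theorem contMDiff_conj (k : K) :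
    ContMDiff (𝓡 d) (𝓡 d) ∞ (fun g : K => k * g * k⁻¹) :=
  (contMDiff_const.mul contMDiff_id).mul contMDiff_const

theorem tendsto_conj_chartOne_symm (k : K) :
    Tendsto (fun a => k * (chartOne d K).symm a * k⁻¹) (𝓝 (coordOne d K)) (𝓝 1) := by
  have := ((contMDiff_conj (d := d) k).continuous).tendsto 1
  rw [mul_one, mul_inv_cancel] at this
  exact this.comp tendsto_chartOne_symm

theorem differentiableAt_conjChart (k : K) :
    DifferentiableAt ℝ (conjChart (d := d) k) (coordOne d K) := by
  have h4 : ContMDiffAt (𝓡 d) 𝓘(ℝ, EuclideanSpace ℝ (Fin d)) ∞ (chartOne d K)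
      (k * (chartOne d K).symm (coordOne d K) * k⁻¹) := by
    rw [chartOne_symm_coordOne, mul_one, mul_inv_cancel]
    exact contMDiffAt_extChartAt
  have h5 := (ContMDiffAt.comp (coordOne d K) h4
    ((contMDiff_conj k).contMDiffAt.comp (coordOne d K) contMDiffAt_chartOne_symm)).contDiffAt
  exact h5.differentiableAt (by simp)

/-- The adjoint action is the derivative of the conjugation in the chart. -/
theorem Ad_eq_fderiv (k : K) (x : GroupLieAlgebra (𝓡 d) K) :
    Ad k x = (fderiv ℝ (conjChart k) (coordOne d K) : _ → EuclideanSpace ℝ (Fin d)) x := by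
  have hd : MDifferentiableAt (𝓡 d) (𝓡 d) (fun g : K => k * g * k⁻¹) 1 :=
    (contMDiff_conj k).mdifferentiableAt (by simp)
  refine (DFunLike.congr_fun hd.mfderiv x).trans ?_
  have h2 : writtenInExtChartAt (𝓡 d) (𝓡 d) (1 : K) (fun g : K => k * g * k⁻¹) =
      conjChart k := by
    ext1 b
    simp only [writtenInExtChartAt, Function.comp_apply, conjChart, mul_one, mul_inv_cancel]
  have h3 : Set.range (𝓡 d) = Set.univ := by simp
  have h4 : fderivWithin ℝ (writtenInExtChartAt (𝓡 d) (𝓡 d) (1 : K) (fun g : K => k * g * k⁻¹))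
      (Set.range (𝓡 d)) (coordOne d K) = fderiv ℝ (conjChart k) (coordOne d K) := by
    rw [h2, h3, fderivWithin_univ]
  exact DFunLike.congr_fun h4 x

theorem Ad_mul (k l : K) (x : GroupLieAlgebra (𝓡 d) K) : Ad (k * l) x = Ad k (Ad l x) := by
  rw [Ad_eq_fderiv, Ad_eq_fderiv, Ad_eq_fderiv]
  have hev : conjChart (d := d) (k * l) =ᶠ[𝓝 (coordOne d K)] conjChart k ∘ conjChart l := by
    filter_upwards [(tendsto_conj_chartOne_symm (d := d) l).eventually
      (eventually_chartOne_left_inv (d := d))] with a ha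
    rw [Function.comp_apply, conjChart, conjChart, conjChart, ha]
    simp only [mul_inv_rev, mul_assoc]
  rw [hev.fderiv_eq, fderiv_comp, conjChart_coordOne]
  · rfl
  · rw [conjChart_coordOne]; exact differentiableAt_conjChart k
  · exact differentiableAt_conjChart l

theorem Ad_one (x : GroupLieAlgebra (𝓡 d) K) : Ad (1 : K) x = x := by
  rw [Ad_eq_fderiv]
  have hev : conjChart (d := d) (1 : K) =ᶠ[𝓝 (coordOne d K)] id := by
    filter_upwards [eventually_chartOne_right_inv (d := d) (K := K)] with a ha
    simpa [conjChart] using ha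
  rw [hev.fderiv_eq, fderiv_id]
  rfl

/-- The left-invariant vector fields, read in the chart at the identity. -/
theorem eventually_mpullbackWithin_mulInvariantVectorField (w : GroupLieAlgebra (𝓡 d) K) :
    ∀ᶠ a in 𝓝 (coordOne d K),
      (mpullbackWithin 𝓘(ℝ, EuclideanSpace ℝ (Fin d)) (𝓡 d) (chartOne d K).symm
        (mulInvariantVectorField w) (Set.range (𝓡 d)) a : EuclideanSpace ℝ (Fin d)) =
      (fderiv ℝ (fun b => mulChart (K := K) (a, b)) (coordOne d K) :
        EuclideanSpace ℝ (Fin d) → EuclideanSpace ℝ (Fin d)) w := by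
  have : IsManifold (𝓡 d) 1 K := IsManifold.of_le (n := ∞) ENat.LEInfty.out
  filter_upwards [extChartAt_target_mem_nhds (I := 𝓡 d) (1 : K)] with a ha
  set g := (chartOne d K).symm a with hg
  have hgs : g ∈ (chartOne d K).source := (chartOne d K).map_target ha
  have hinv : (mfderivWithin 𝓘(ℝ, EuclideanSpace ℝ (Fin d)) (𝓡 d) (chartOne d K).symm
      (Set.range (𝓡 d)) a).inverse =
      mfderiv (𝓡 d) 𝓘(ℝ, EuclideanSpace ℝ (Fin d)) (chartOne d K) g :=
    ContinuousLinearMap.inverse_eq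
      (mfderivWithin_extChartAt_symm_comp_mfderiv_extChartAt ha)
      (mfderiv_extChartAt_comp_mfderivWithin_extChartAt_symm ha)
  have hmul : MDifferentiableAt (𝓡 d) (𝓡 d) (g * ·) (1 : K) :=
    (contMDiff_mul_left (n := ∞)).mdifferentiableAt (by simp)
  have hφ : MDifferentiableAt (𝓡 d) 𝓘(ℝ, EuclideanSpace ℝ (Fin d)) (chartOne d K) (g * 1) := by
    rw [mul_one]
    exact mdifferentiableAt_extChartAt (by simpa using hgs)
  -- `g * 1` and `g` agree only propositionally, so the derivative is carried from one base point to
  -- the other by substitution.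
  have hpoint : ∀ (g' : K), g' = g → ∀ u : EuclideanSpace ℝ (Fin d),
      (mfderiv (𝓡 d) 𝓘(ℝ, EuclideanSpace ℝ (Fin d)) (chartOne d K) g' :
        EuclideanSpace ℝ (Fin d) → EuclideanSpace ℝ (Fin d)) u =
      (mfderiv (𝓡 d) 𝓘(ℝ, EuclideanSpace ℝ (Fin d)) (chartOne d K) g :
        EuclideanSpace ℝ (Fin d) → EuclideanSpace ℝ (Fin d)) u := by
    rintro g' rfl u; rfl
  have hcomp := DFunLike.congr_fun (mfderiv_comp (1 : K) hφ hmul) w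
  have hd : MDifferentiableAt (𝓡 d) 𝓘(ℝ, EuclideanSpace ℝ (Fin d))
      (chartOne d K ∘ (g * ·)) (1 : K) := hφ.comp (1 : K) hmul
  refine (DFunLike.congr_fun hinv _).trans ?_
  refine (hpoint (g * 1) (mul_one g) _).symm.trans ?_
  refine hcomp.symm.trans ?_
  refine (DFunLike.congr_fun hd.mfderiv w).trans ?_
  have h2 : writtenInExtChartAt (𝓡 d) 𝓘(ℝ, EuclideanSpace ℝ (Fin d)) (1 : K)
      (chartOne d K ∘ (g * ·)) = fun b => mulChart (K := K) (a, b) := by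
    ext1 b
    rfl
  have h3 : Set.range (𝓡 d) = Set.univ := by simp
  have h4 : fderivWithin ℝ (writtenInExtChartAt (𝓡 d) 𝓘(ℝ, EuclideanSpace ℝ (Fin d)) (1 : K)
      (chartOne d K ∘ (g * ·)))
      (Set.range (𝓡 d)) (coordOne d K) =
      fderiv ℝ (fun b => mulChart (K := K) (a, b)) (coordOne d K) := by
    rw [h2, h3, fderivWithin_univ]
  exact DFunLike.congr_fun h4 w

/-- Read in itself the chart is the identity. This removes the outer factor from the bracket, which
is computed in the chart and then pulled back. -/
theorem inverse_mfderiv_chartOne (u : EuclideanSpace ℝ (Fin d)) :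
    ((mfderiv (𝓡 d) 𝓘(ℝ, EuclideanSpace ℝ (Fin d)) (chartOne d K) (1 : K)).inverse :
      EuclideanSpace ℝ (Fin d) → EuclideanSpace ℝ (Fin d)) u = u := by
  have : IsManifold (𝓡 d) 1 K := IsManifold.of_le (n := ∞) ENat.LEInfty.out
  have hd : MDifferentiableAt (𝓡 d) 𝓘(ℝ, EuclideanSpace ℝ (Fin d)) (chartOne d K) (1 : K) :=
    mdifferentiableAt_extChartAt (by simp)
  have h2 : writtenInExtChartAt (𝓡 d) 𝓘(ℝ, EuclideanSpace ℝ (Fin d)) (1 : K)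
      (chartOne d K) =ᶠ[𝓝 (coordOne d K)] id := by
    filter_upwards [eventually_chartOne_right_inv (d := d) (K := K)] with a ha
    exact ha
  have h3 : Set.range (𝓡 d) = Set.univ := by simp
  have h4 : fderivWithin ℝ (writtenInExtChartAt (𝓡 d) 𝓘(ℝ, EuclideanSpace ℝ (Fin d)) (1 : K)
      (chartOne d K)) (Set.range (𝓡 d)) (coordOne d K) = ContinuousLinearMap.id ℝ _ := by
    rw [h3, fderivWithin_univ, h2.fderiv_eq, fderiv_id]
  have h5 : mfderiv (𝓡 d) 𝓘(ℝ, EuclideanSpace ℝ (Fin d)) (chartOne d K) (1 : K) =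
      ContinuousLinearMap.id ℝ (EuclideanSpace ℝ (Fin d)) := hd.mfderiv.trans h4
  have h6 : (mfderiv (𝓡 d) 𝓘(ℝ, EuclideanSpace ℝ (Fin d)) (chartOne d K) (1 : K)).inverse =
      (ContinuousLinearMap.id ℝ (EuclideanSpace ℝ (Fin d))).inverse :=
    congrArg ContinuousLinearMap.inverse h5
  have h7 := h6.trans ContinuousLinearMap.inverse_id
  exact DFunLike.congr_fun h7 u

/-- The bracket of the Lie algebra, in terms of the multiplication in the chart at the identity. -/
theorem bracket_eq_fderiv_mulChart (v w : GroupLieAlgebra (𝓡 d) K) :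
    (⁅v, w⁆ : GroupLieAlgebra (𝓡 d) K) =
      (fderiv ℝ (fun a => (fderiv ℝ (fun b => mulChart (K := K) (a, b)) (coordOne d K) :
        EuclideanSpace ℝ (Fin d) → EuclideanSpace ℝ (Fin d)) w) (coordOne d K) v -
      fderiv ℝ (fun a => (fderiv ℝ (fun b => mulChart (K := K) (a, b)) (coordOne d K) :
        EuclideanSpace ℝ (Fin d) → EuclideanSpace ℝ (Fin d)) v) (coordOne d K) w :
        EuclideanSpace ℝ (Fin d)) := by
  refine (inverse_mfderiv_chartOne (d := d) (K := K) _).trans ?_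
  have hs : (chartOne d K).symm ⁻¹' Set.univ ∩ Set.range (𝓡 d) = Set.univ := by simp
  have hv := eventually_mpullbackWithin_mulInvariantVectorField (d := d) (K := K) v
  have hw := eventually_mpullbackWithin_mulInvariantVectorField (d := d) (K := K) w
  have hone : ∀ u : EuclideanSpace ℝ (Fin d),
      fderiv ℝ (fun b => mulChart (K := K) (coordOne d K, b)) (coordOne d K) u = u := by
    intro u
    have hev : (fun b => mulChart (K := K) (coordOne d K, b)) =ᶠ[𝓝 (coordOne d K)] id := by
      filter_upwards [eventually_chartOne_right_inv (d := d) (K := K)] with b hb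
      rw [mulChart, chartOne_symm_coordOne, one_mul, hb, id]
    rw [hev.fderiv_eq, fderiv_id]
    rfl
  have key := Filter.EventuallyEq.lieBracketWithin_vectorField_eq (𝕜 := ℝ)
    (s := (chartOne d K).symm ⁻¹' Set.univ ∩ Set.range (𝓡 d))
    (hv.filter_mono nhdsWithin_le_nhds) hv.self_of_nhds
    (hw.filter_mono nhdsWithin_le_nhds) hw.self_of_nhds
  refine key.trans ?_
  rw [hs, lieBracketWithin_univ, lieBracket]
  exact congrArg₂ (· - ·) (congrArg _ (hone v)) (congrArg _ (hone w))

/-- The orbit map `g ↦ Ad g x`, read in the chart at the identity. -/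
def adOrbitChart (x : GroupLieAlgebra (𝓡 d) K) (a : EuclideanSpace ℝ (Fin d)) :
    EuclideanSpace ℝ (Fin d) :=
  Ad ((chartOne d K).symm a) x

/-- The derivative of the adjoint action at the identity is the bracket. -/
theorem exists_hasFDerivAt_Ad (x : GroupLieAlgebra (𝓡 d) K) :
    ∃ D : EuclideanSpace ℝ (Fin d) →L[ℝ] EuclideanSpace ℝ (Fin d),
      HasFDerivAt (adOrbitChart x) D (coordOne d K) ∧
        ∀ v : GroupLieAlgebra (𝓡 d) K, D v = ⁅v, x⁆ := by
  have hsymm : Tendsto (fun p : EuclideanSpace ℝ (Fin d) × EuclideanSpace ℝ (Fin d) =>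
      (chartOne d K).symm p.1 * (chartOne d K).symm p.2 * ((chartOne d K).symm p.1)⁻¹)
      (𝓝 (coordOne d K, coordOne d K)) (𝓝 1) := by
    have : IsTopologicalGroup K := topologicalGroup_of_lieGroup (𝓡 d) ∞
    have h1 : Tendsto (fun p : EuclideanSpace ℝ (Fin d) × EuclideanSpace ℝ (Fin d) =>
        (chartOne d K).symm p.1) (𝓝 (coordOne d K, coordOne d K)) (𝓝 1) :=
      tendsto_chartOne_symm.comp (continuous_fst.tendsto _)
    have h2 : Tendsto (fun p : EuclideanSpace ℝ (Fin d) × EuclideanSpace ℝ (Fin d) =>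
        (chartOne d K).symm p.2) (𝓝 (coordOne d K, coordOne d K)) (𝓝 1) :=
      tendsto_chartOne_symm.comp (continuous_snd.tendsto _)
    simpa using (h1.mul h2).mul h1.inv
  have hMC : ∀ᶠ p in 𝓝 (coordOne d K, coordOne d K), mulChart (K := K)
      (conjChart ((chartOne d K).symm p.1) p.2, p.1) = mulChart (K := K) p := by
    filter_upwards [hsymm.eventually (eventually_chartOne_left_inv (d := d))] with p hp
    rw [mulChart, mulChart, conjChart, hp, inv_mul_cancel_right]
  have hMr : ∀ᶠ a in 𝓝 (coordOne d K), mulChart (K := K) (a, coordOne d K) = a := by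
    filter_upwards [eventually_chartOne_right_inv (d := d) (K := K)] with a ha
    rw [mulChart, chartOne_symm_coordOne, mul_one, ha]
  have hCb : ∀ᶠ b in 𝓝 (coordOne d K), conjChart ((chartOne d K).symm (coordOne d K)) b = b := by
    filter_upwards [eventually_chartOne_right_inv (d := d) (K := K)] with a ha
    simp only [chartOne_symm_coordOne, conjChart, one_mul, inv_one, mul_one, ha]
  obtain ⟨D, hD, hDv⟩ := hasFDerivAt_fderiv_conj
    (M := mulChart (K := K)) (C := fun p => conjChart ((chartOne d K).symm p.1) p.2)
    contDiffAt_mulChart contDiffAt_conjChart_uncurry hMC hMr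
    (Eventually.of_forall fun a => conjChart_coordOne _) hCb x
  refine ⟨D, ?_, fun v => (hDv v).trans (bracket_eq_fderiv_mulChart v x).symm⟩
  exact hD.congr_of_eventuallyEq (Eventually.of_forall fun a => Ad_eq_fderiv _ x)

/-- Differentiate `Ad k (Ad g x) = Ad (k g k⁻¹) (Ad k x)` in `g` at the identity. -/
theorem Ad_lie (k : K) (v x : GroupLieAlgebra (𝓡 d) K) : Ad k ⁅v, x⁆ = ⁅Ad k v, Ad k x⁆ := by
  obtain ⟨D, hD, hDv⟩ := exists_hasFDerivAt_Ad x
  obtain ⟨D', hD', hDv'⟩ := exists_hasFDerivAt_Ad (Ad k x)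
  have hk := (differentiableAt_conjChart (d := d) k).hasFDerivAt
  have h1 := HasFDerivAt.comp (coordOne d K)
    (fderiv ℝ (conjChart k) (coordOne d K)).hasFDerivAt hD
  rw [← conjChart_coordOne (d := d) k] at hD'
  have h2 := HasFDerivAt.comp (coordOne d K) hD' hk
  have hev : fderiv ℝ (conjChart k) (coordOne d K) ∘ adOrbitChart x =ᶠ[𝓝 (coordOne d K)]
      adOrbitChart (Ad k x) ∘ conjChart k := by
    filter_upwards [(tendsto_conj_chartOne_symm (d := d) k).eventually
      (eventually_chartOne_left_inv (d := d))] with a ha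
    rw [Function.comp_apply, Function.comp_apply, adOrbitChart, adOrbitChart, conjChart, ha]
    refine (Ad_eq_fderiv k _).symm.trans ?_
    rw [← Ad_mul, ← Ad_mul, inv_mul_cancel_right]
  have h3 := DFunLike.congr_fun (h1.unique (h2.congr_of_eventuallyEq hev)) v
  have h4 := (Ad_eq_fderiv k ⁅v, x⁆).trans
    ((congrArg (fderiv ℝ (conjChart k) (coordOne d K)) (hDv v).symm).trans h3)
  refine h4.trans ?_
  refine Eq.trans ?_ (hDv' (Ad k v))
  exact congrArg D' (Ad_eq_fderiv k v).symm

/-- The adjoint action as an automorphism of the Lie algebra. -/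
def AdEquiv (k : K) : GroupLieAlgebra (𝓡 d) K ≃ₗ⁅ℝ⁆ GroupLieAlgebra (𝓡 d) K where
  toLinearMap := Ad k
  map_lie' := Ad_lie k _ _
  invFun := Ad k⁻¹
  left_inv x := by
    change Ad k⁻¹ (Ad k x) = x
    rw [← Ad_mul, inv_mul_cancel, Ad_one]
  right_inv x := by
    change Ad k (Ad k⁻¹ x) = x
    rw [← Ad_mul, mul_inv_cancel, Ad_one]

/-- Every `v` in the Lie algebra is the velocity of a curve in the group along which the adjoint
action has derivative `ad v`. -/
theorem exists_curve_hasDerivAt_Ad (v : GroupLieAlgebra (𝓡 d) K) :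
    ∃ γ : ℝ → K, γ 0 = 1 ∧ ∀ (x : GroupLieAlgebra (𝓡 d) K)
      (φ : Module.Dual ℝ (GroupLieAlgebra (𝓡 d) K)),
      HasDerivAt (fun t => φ (Ad (γ t) x)) (φ ⁅v, x⁆) 0 := by
  -- `u` is `v` viewed in the model space; the curve is the straight line with velocity `u` in the
  -- chart.
  obtain ⟨u, hu⟩ : ∃ u : EuclideanSpace ℝ (Fin d), u = v := ⟨v, rfl⟩
  refine ⟨fun t => (chartOne d K).symm (coordOne d K + t • u), ?_, fun x φ => ?_⟩
  · change (chartOne d K).symm (coordOne d K + (0 : ℝ) • u) = 1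
    rw [zero_smul, add_zero, chartOne_symm_coordOne]
  obtain ⟨D, hD, hDv⟩ := exists_hasFDerivAt_Ad x
  have h1 : HasDerivAt (fun t : ℝ => coordOne d K + t • u) u 0 := by
    simpa using ((hasDerivAt_id (0 : ℝ)).smul_const u).const_add (coordOne d K)
  have h2 : HasFDerivAt (adOrbitChart x) D
      (coordOne d K + (0 : ℝ) • u) := by
    rwa [zero_smul, add_zero]
  let ψ : EuclideanSpace ℝ (Fin d) →ₗ[ℝ] ℝ := φ
  have h3 := (LinearMap.toContinuousLinearMap ψ).hasFDerivAt.comp_hasDerivAt (0 : ℝ)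
    (h2.comp_hasDerivAt (0 : ℝ) h1)
  exact h3.congr_deriv (congrArg φ ((congrArg D hu).trans (hDv v)))

end Group

/-! ### Pairs of generators -/

section Generators

open LieAlgebra LieAlgebra.IsKilling LieModule

variable {𝕜 L : Type*} [Field 𝕜] [LieRing L] [LieAlgebra 𝕜 L]

/-- A Lie subalgebra that contains all root spaces is everything. -/
theorem eq_top_of_rootSpace_le [CharZero 𝕜] [FiniteDimensional 𝕜 L] [IsKilling 𝕜 L]
    {H : LieSubalgebra 𝕜 L} [H.IsCartanSubalgebra] [IsTriangularizable 𝕜 H L]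
    (S : LieSubalgebra 𝕜 L)
    (hS : ∀ α : Weight 𝕜 H L, α.IsNonZero → ∀ y ∈ rootSpace H α, y ∈ S) : S = ⊤ := by
  -- Each coroot is `[e, f]` for an `sl₂`-triple of root vectors, and the coroots span the Cartan
  -- subalgebra.
  have hcoroot : ∀ α : H.root, ((coroot α.1 : H) : L) ∈ S := by
    intro α
    have hα : α.1.IsNonZero := LieSubalgebra.isNonZero_coe_root α
    obtain ⟨h, e, f, ht, he, hf⟩ := exists_isSl2Triple_of_weight_isNonZero hα
    rw [← ht.h_eq_coroot hα he hf, ← ht.lie_e_f]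
    exact S.lie_mem (hS _ hα _ he) (hS (-α.1) hα.neg _ (by simpa using hf))
  have hH : ∀ y : H, (y : L) ∈ S := by
    intro y
    have hy : y ∈ Submodule.span 𝕜 (Set.range (rootSystem H).coroot) := by
      rw [RootPairing.IsRootSystem.span_coroot_eq_top (P := rootSystem H)]
      trivial
    have hle : Submodule.span 𝕜 (Set.range (rootSystem H).coroot) ≤
        S.toSubmodule.comap H.toSubmodule.subtype := by
      rw [Submodule.span_le]
      rintro _ ⟨α, rfl⟩
      exact hcoroot α
    exact hle hy
  have htop := cartan_sup_iSup_rootSpace_eq_top (K := 𝕜) (L := L) (H := H)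
  rw [← LieSubalgebra.toSubmodule_inj, LieSubalgebra.top_toSubmodule, eq_top_iff,
    ← LieSubmodule.top_toSubmodule (R := 𝕜) (L := H) (M := L), ← htop]
  simp only [LieSubmodule.sup_toSubmodule, LieSubmodule.iSup_toSubmodule, sup_le_iff, iSup_le_iff]
  exact ⟨fun y hy => hH ⟨y, hy⟩, fun α hα y hy => hS α hα y hy⟩

/-- A Lie algebra with nondegenerate Killing form over an algebraically closed field of
characteristic zero is generated by two elements. -/
theorem exists_lieSpan_pair_eq_top_of_isAlgClosed (𝕜 L : Type*) [Field 𝕜] [LieRing L]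
    [LieAlgebra 𝕜 L] [CharZero 𝕜] [IsAlgClosed 𝕜]
    [FiniteDimensional 𝕜 L] [IsKilling 𝕜 L] :
    ∃ x : Fin 2 → L, LieSubalgebra.lieSpan 𝕜 L (Set.range x) = ⊤ := by
  obtain ⟨x₀, hx₀⟩ := exists_isCartanSubalgebra_engel 𝕜 L
  set H := LieSubalgebra.engel 𝕜 x₀
  classical
  -- `h` avoids the finitely many hyperplanes on which two distinct roots agree; `h` and a sum of
  -- root vectors, one for each root, will be the generators.
  obtain ⟨h, hh⟩ : ∃ h : H, ∀ p : {p : H.root × H.root // p.1 ≠ p.2},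
      ((p.1.1.1 : Weight 𝕜 H L).toLinear - (p.1.2.1 : Weight 𝕜 H L).toLinear) h ≠ 0 := by
    apply Module.Dual.exists_forall_ne_zero_of_forall_exists
    rintro ⟨⟨α, β⟩, hαβ⟩
    by_contra! hcon
    apply hαβ
    apply Subtype.ext
    apply Weight.ext
    intro x
    have := hcon x
    simpa [sub_eq_zero] using this
  choose e he he0 using fun α : Weight 𝕜 H L => α.exists_ne_zero
  set y : L := ∑ α : H.root, e α
  refine ⟨![(h : L), y], ?_⟩
  set S := LieSubalgebra.lieSpan 𝕜 L (Set.range ![(h : L), y])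
  have hhS : (h : L) ∈ S := LieSubalgebra.subset_lieSpan ⟨0, rfl⟩
  have hyS : y ∈ S := LieSubalgebra.subset_lieSpan ⟨1, rfl⟩
  apply eq_top_of_rootSpace_le (H := H)
  intro α hα z hz
  have heS : e α ∈ S := by
    let a : H.root := ⟨α, by simpa using hα⟩
    have hinj : Set.InjOn (fun β : H.root => (β.1 : Weight 𝕜 H L) h)
        (Finset.univ : Finset H.root) := by
      intro β _ γ _ hβγ
      by_contra hne
      exact hh ⟨(β, γ), hne⟩ (by simpa [sub_eq_zero] using hβγ)
    -- The root vectors in `y` have distinct eigenvalues under `ad h`, so the interpolation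
    -- polynomial that is `1` at `α h` and `0` at the other roots isolates `e α`.
    let p := Lagrange.basis Finset.univ (fun β : H.root => (β.1 : Weight 𝕜 H L) h) a
    have hp : Polynomial.aeval (ad 𝕜 L h) p y = e α := by
      rw [map_sum, Finset.sum_eq_single a]
      · rw [Module.End.aeval_apply_of_mem_apply_eq_smul (μ := (α : Weight 𝕜 H L) h)
          (lie_eq_smul_of_mem_rootSpace (he α) h)]
        have : p.eval (α h) = 1 := Lagrange.eval_basis_self hinj (Finset.mem_univ a)
        rw [this, one_smul]
      · intro b _ hb
        rw [Module.End.aeval_apply_of_mem_apply_eq_smul (μ := (b.1 : Weight 𝕜 H L) h)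
          (lie_eq_smul_of_mem_rootSpace (he b) h)]
        have : p.eval (b.1 h) = 0 := Lagrange.eval_basis_of_ne
          (v := fun β : H.root => (β.1 : Weight 𝕜 H L) h) hb.symm (Finset.mem_univ b)
        rw [this, zero_smul]
      · simp
    rw [← hp]
    exact Polynomial.aeval_apply_smul_mem_of_le_comap (q := S.toSubmodule) hyS p _
      fun w hw => S.lie_mem hhS hw
  obtain ⟨c, hc⟩ := (finrank_eq_one_iff_of_nonzero' (⟨e α, he α⟩ : rootSpace H α)
    (by simpa [Subtype.ext_iff] using he0 α)).1 (finrank_rootSpace_eq_one α hα) ⟨z, hz⟩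
  have hcz : c • e α = z := congrArg Subtype.val hc
  rw [← hcz]
  exact S.smul_mem c heS

open scoped TensorProduct

/-- The Killing form stays nondegenerate under extension of scalars. -/
theorem isKilling_baseChange (𝕜 A L : Type*) [Field 𝕜] [Field A] [Algebra 𝕜 A] [LieRing L]
    [LieAlgebra 𝕜 L] [FiniteDimensional 𝕜 L] [IsKilling 𝕜 L] : IsKilling A (A ⊗[𝕜] L) := by
  classical
  let b := Module.finBasis 𝕜 L
  have hnd := killingForm_nondegenerate 𝕜 L
  let b' := LinearMap.BilinForm.dualBasis (killingForm 𝕜 L) hnd b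
  refine ⟨(LieSubmodule.eq_bot_iff _).2 fun z hz => ?_⟩
  have hz' : ∀ y : A ⊗[𝕜] L, killingForm A (A ⊗[𝕜] L) y z = 0 := fun y =>
    (LieIdeal.mem_killingCompl A (A ⊗[𝕜] L) ⊤).1 hz y trivial
  rw [← (b.baseChange A).sum_repr z]
  refine Finset.sum_eq_zero fun i _ => ?_
  -- Pairing with the dual basis vector reads off the `i`-th coordinate of `z`.
  have h1 := hz' (1 ⊗ₜ b' i)
  rw [killingForm, traceForm_baseChange, ← (b.baseChange A).sum_repr z] at h1
  have h2 : ∀ j, killingForm 𝕜 L (b' i) (b j) = if j = i then 1 else 0 := by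
    intro j
    exact LinearMap.BilinForm.apply_dualBasis_left hnd b i j
  have h3 : ∀ j, traceForm 𝕜 L L (b' i) (b j) = if j = i then 1 else 0 := h2
  simp [h3] at h1
  simp [h1]

end Generators

/-! ### Iterated brackets -/

section Words

variable {κ : Type*}

/-- The value at `x` of an iterated bracket of the letters `x i`. -/
def lieWord {L : Type*} [Bracket L L] (x : κ → L) : FreeMagma κ → L
  | .of i => x i
  | .mul a b => ⁅lieWord x a, lieWord x b⁆

/-- By bilinearity the span of the words is itself closed under brackets. -/
theorem span_range_lieWord (R : Type*) {L : Type*} [CommRing R] [LieRing L] [LieAlgebra R L]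
    (x : κ → L) : Submodule.span R (Set.range (lieWord x)) =
      (LieSubalgebra.lieSpan R L (Set.range x)).toSubmodule := by
  apply le_antisymm
  · rw [Submodule.span_le]
    rintro _ ⟨w, rfl⟩
    induction w with
    | ih1 i => exact LieSubalgebra.subset_lieSpan ⟨i, rfl⟩
    | ih2 a b ha hb => exact LieSubalgebra.lie_mem _ ha hb
  · let S : LieSubalgebra R L :=
      { Submodule.span R (Set.range (lieWord x)) with
        lie_mem' := by
          intro u v hu hv
          change u ∈ Submodule.span R (Set.range (lieWord x)) at hu
          change v ∈ Submodule.span R (Set.range (lieWord x)) at hv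
          change ⁅u, v⁆ ∈ Submodule.span R (Set.range (lieWord x))
          induction hu, hv using Submodule.span_induction₂ with
          | mem_mem u v hu hv =>
            obtain ⟨a, rfl⟩ := hu
            obtain ⟨b, rfl⟩ := hv
            exact Submodule.subset_span ⟨.mul a b, rfl⟩
          | zero_left v _ => simp
          | zero_right u _ => simp
          | add_left u v w _ _ _ h1 h2 => rw [add_lie]; exact add_mem h1 h2
          | add_right u v w _ _ _ h1 h2 => rw [lie_add]; exact add_mem h1 h2
          | smul_left r u v _ _ h => rw [smul_lie]; exact Submodule.smul_mem _ _ h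
          | smul_right r u v _ _ h => rw [lie_smul]; exact Submodule.smul_mem _ _ h }
    have : LieSubalgebra.lieSpan R L (Set.range x) ≤ S := by
      rw [LieSubalgebra.lieSpan_le]
      rintro _ ⟨i, rfl⟩
      exact Submodule.subset_span ⟨.of i, rfl⟩
    exact this

/-- Elements generate a Lie algebra if and only if some iterated brackets of them form a basis. -/
theorem lieSpan_eq_top_iff_exists_det {F L : Type*} [Field F] [LieRing L] [LieAlgebra F L]
    {m : ℕ} (b : Module.Basis (Fin m) F L) (x : κ → L) :
    LieSubalgebra.lieSpan F L (Set.range x) = ⊤ ↔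
      ∃ W : Fin m → FreeMagma κ, b.det (fun j => lieWord x (W j)) ≠ 0 := by
  rw [← LieSubalgebra.toSubmodule_inj, LieSubalgebra.top_toSubmodule, ← span_range_lieWord F x]
  have : Module.Finite F L := Module.Finite.of_basis b
  constructor
  · intro h
    obtain ⟨f, hf, hspan, hli⟩ :=
      Submodule.exists_fun_fin_finrank_span_eq F (Set.range (lieWord x))
    have hm : Module.finrank F (Submodule.span F (Set.range (lieWord x))) = m := by
      rw [h, finrank_top, Module.finrank_eq_card_basis b, Fintype.card_fin]
    choose W hW using hf
    refine ⟨fun j => W (Fin.cast hm.symm j), ?_⟩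
    have h1 : (fun j => lieWord x (W (Fin.cast hm.symm j))) = f ∘ Fin.cast hm.symm := by
      ext1 j
      exact hW _
    rw [h1]
    apply IsUnit.ne_zero
    rw [← Module.Basis.is_basis_iff_det]
    refine ⟨hli.comp _ (Fin.cast_injective _), ?_⟩
    have h2 : Function.Surjective (Fin.cast hm.symm) := (finCongr hm.symm).surjective
    rw [h2.range_comp, hspan, h]
  · rintro ⟨W, hW⟩
    have h1 := ((Module.Basis.is_basis_iff_det b).2 hW.isUnit).2
    rw [eq_top_iff, ← h1]
    exact Submodule.span_mono (Set.range_comp_subset_range W (lieWord x))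

/-- Iterated brackets in coordinates, for the structure constants `c`. -/
def wordCoord {ι R A : Type*} [Fintype ι] [CommRing R] [CommRing A] [Algebra R A]
    (c : ι → ι → ι → R) (u : κ → ι → A) : FreeMagma κ → ι → A
  | .of i => u i
  | .mul v w => fun k => ∑ i, ∑ j, algebraMap R A (c i j k) * wordCoord c u v i * wordCoord c u w j

/-- Coordinates of words are universal polynomials in those of the letters. One determinant of words
can thus be evaluated both over a field and over its algebraic closure. -/
theorem map_wordCoord {ι R A B : Type*} [Fintype ι] [CommRing R] [CommRing A] [Algebra R A]
    [CommRing B] [Algebra R B] (c : ι → ι → ι → R) (u : κ → ι → A) (φ : A →ₐ[R] B)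
    (w : FreeMagma κ) (k : ι) :
    φ (wordCoord c u w k) = wordCoord c (fun i j => φ (u i j)) w k := by
  induction w generalizing k with
  | ih1 i => rfl
  | ih2 a b ha hb =>
    change φ (∑ i, ∑ j, algebraMap R A (c i j k) * wordCoord c u a i * wordCoord c u b j) = _
    simp only [map_sum, map_mul, ha, hb, AlgHom.commutes]
    rfl

theorem repr_lieWord {ι R A L : Type*} [Fintype ι] [CommRing R] [CommRing A] [Algebra R A]
    [LieRing L] [LieAlgebra A L] (b : Module.Basis ι A L) (c : ι → ι → ι → R)
    (hc : ∀ i j k, b.repr ⁅b i, b j⁆ k = algebraMap R A (c i j k)) (x : κ → L)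
    (w : FreeMagma κ) (k : ι) :
    b.repr (lieWord x w) k = wordCoord c (fun i j => b.repr (x i) j) w k := by
  induction w generalizing k with
  | ih1 i => rfl
  | ih2 v w hv hw =>
    have h1 := b.sum_repr (lieWord x v)
    have h2 := b.sum_repr (lieWord x w)
    change b.repr ⁅lieWord x v, lieWord x w⁆ k = _
    rw [← h1, ← h2]
    change _ = ∑ i, ∑ j, algebraMap R A (c i j k) * wordCoord c (fun i j => b.repr (x i) j) v i *
      wordCoord c (fun i j => b.repr (x i) j) w j
    simp only [sum_lie, lie_sum, smul_lie, lie_smul, map_sum,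
      map_smul, Finsupp.coe_finsetSum, Finset.sum_apply, Finsupp.smul_apply, hc, smul_eq_mul,
      ← hv, ← hw, Finset.mul_sum]
    rw [Finset.sum_comm]
    refine Finset.sum_congr rfl fun i _ => Finset.sum_congr rfl fun j _ => ?_
    ring

open scoped TensorProduct

/-- A Lie algebra with nondegenerate Killing form over a field of characteristic zero is generated
by two elements. -/
theorem exists_lieSpan_pair_eq_top (F L : Type*) [Field F] [CharZero F] [LieRing L]
    [LieAlgebra F L] [FiniteDimensional F L] [LieAlgebra.IsKilling F L] :
    ∃ x : Fin 2 → L, LieSubalgebra.lieSpan F L (Set.range x) = ⊤ := by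
  let A := AlgebraicClosure F
  have : LieAlgebra.IsKilling A (A ⊗[F] L) := isKilling_baseChange F A L
  obtain ⟨X, hX⟩ := exists_lieSpan_pair_eq_top_of_isAlgClosed A (A ⊗[F] L)
  let b := Module.finBasis F L
  let c := fun i j k => b.repr ⁅b i, b j⁆ k
  obtain ⟨W, hW⟩ := (lieSpan_eq_top_iff_exists_det (b.baseChange A) X).1 hX
  -- The determinant of the words `W` with generic letters. Its coefficients are in `F` and it is
  -- nonzero at the generators found over `A`, so it is a nonzero polynomial and, `F` being
  -- infinite, is nonzero at some point over `F`.
  let P : MvPolynomial (Fin 2 × Fin (Module.finrank F L)) F :=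
    (Matrix.of fun k j => wordCoord c (fun i l => MvPolynomial.X (R := F) (i, l)) (W j) k).det
  have hP : P ≠ 0 := by
    intro h0
    apply hW
    have h1 := congrArg (MvPolynomial.aeval fun p : Fin 2 × Fin (Module.finrank F L) =>
      (b.baseChange A).repr (X p.1) p.2) h0
    rw [map_zero] at h1
    rw [← h1, Module.Basis.det_apply, AlgHom.map_det]
    congr 1
    ext k j
    simp only [Module.Basis.toMatrix_apply, AlgHom.mapMatrix_apply, Matrix.map_apply,
      Matrix.of_apply, map_wordCoord, MvPolynomial.aeval_X]
    apply repr_lieWord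
    intro i j k
    simp [c, Algebra.algebraMap_eq_smul_one]
  obtain ⟨y, hy⟩ : ∃ y, MvPolynomial.eval y P ≠ 0 := by
    by_contra! hcon
    exact hP (MvPolynomial.funext fun y => by simp [hcon y])
  refine ⟨fun i => ∑ l, y (i, l) • b l, (lieSpan_eq_top_iff_exists_det b _).2 ⟨W, ?_⟩⟩
  convert hy using 1
  rw [Module.Basis.det_apply, ← MvPolynomial.coe_aeval_eq_eval, RingHom.coe_coe, AlgHom.map_det]
  congr 1
  ext k j
  simp only [Module.Basis.toMatrix_apply, AlgHom.mapMatrix_apply, Matrix.map_apply,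
    Matrix.of_apply, map_wordCoord, MvPolynomial.aeval_X]
  rw [repr_lieWord b c (fun _ _ _ => rfl)]
  congr
  ext i l
  simp [Finsupp.single_apply]

end Words

/-! ### Derivatives along curves -/

section WeakDeriv

variable {M N Q : Type*} [AddCommGroup M] [Module ℝ M] [AddCommGroup N] [Module ℝ N]
  [AddCommGroup Q] [Module ℝ Q]

/-- The curve `c` in a (finite-dimensional) real vector space has velocity `v` at time `0`. -/
def HasVelocity (c : ℝ → M) (v : M) : Prop :=
  ∀ φ : Module.Dual ℝ M, HasDerivAt (fun t => φ (c t)) (φ v) 0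

theorem hasVelocity_line (x v : M) : HasVelocity (fun t : ℝ => x + t • v) v := by
  intro φ
  simpa using ((hasDerivAt_id (0 : ℝ)).mul_const (φ v)).const_add (φ x)

theorem HasVelocity.map {c : ℝ → M} {v : M} (h : HasVelocity c v) (f : M →ₗ[ℝ] N) :
    HasVelocity (fun t => f (c t)) (f v) :=
  fun φ => h (φ ∘ₗ f)

theorem HasVelocity.hasDerivAt {c : ℝ → ℝ} {v : ℝ} (h : HasVelocity c v) : HasDerivAt c v 0 :=
  h LinearMap.id

/-- Velocities are tested by functionals, so expanding in bases reduces the Leibniz rule to that for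
real functions and needs no topology on the spaces. -/
theorem HasVelocity.bilin [Module.Finite ℝ M] [Module.Finite ℝ N] {c : ℝ → M} {v : M}
    {e : ℝ → N} {w : N} (hc : HasVelocity c v) (he : HasVelocity e w)
    (B : M →ₗ[ℝ] N →ₗ[ℝ] Q) :
    HasVelocity (fun t => B (c t) (e t)) (B v (e 0) + B (c 0) w) := by
  intro φ
  let a := Module.finBasis ℝ M
  let b := Module.finBasis ℝ N
  have key : ∀ (u : M) (z : N),
      φ (B u z) = ∑ i, ∑ j, a.coord i u * b.coord j z * φ (B (a i) (b j)) := by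
    intro u z
    conv_lhs => rw [← a.sum_repr u, ← b.sum_repr z]
    simp only [map_sum, map_smul, LinearMap.sum_apply, LinearMap.smul_apply, smul_eq_mul,
      Module.Basis.coord_apply, Finset.mul_sum]
    rw [Finset.sum_comm]
    exact Finset.sum_congr rfl fun i _ => Finset.sum_congr rfl fun j _ => by ring
  have h : HasDerivAt (fun t => ∑ i, ∑ j, a.coord i (c t) * b.coord j (e t) * φ (B (a i) (b j)))
      (∑ i, ∑ j, (a.coord i v * b.coord j (e 0) + a.coord i (c 0) * b.coord j w) *
        φ (B (a i) (b j))) 0 :=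
    HasDerivAt.fun_sum fun i _ => HasDerivAt.fun_sum fun j _ =>
      ((hc (a.coord i)).mul (he (b.coord j))).mul_const _
  have hfun : (fun t => φ (B (c t) (e t))) =
      fun t => ∑ i, ∑ j, a.coord i (c t) * b.coord j (e t) * φ (B (a i) (b j)) :=
    funext fun t => key _ _
  rw [hfun]
  refine h.congr_deriv ?_
  rw [map_add, key v, key (c 0), ← Finset.sum_add_distrib]
  refine Finset.sum_congr rfl fun i _ => ?_
  rw [← Finset.sum_add_distrib]
  exact Finset.sum_congr rfl fun j _ => by ring

/-- A polynomial function has a differential at every point, which computes its derivative along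
curves. -/
theorem exists_differential_of_mem_polynomialAlgebra {f : M → ℝ} (hf : f ∈ polynomialAlgebra M)
    (x : M) : ∃ D : Module.Dual ℝ M, ∀ (c : ℝ → M) (v : M), c 0 = x → HasVelocity c v →
      HasDerivAt (fun t => f (c t)) (D v) 0 := by
  induction hf using Algebra.adjoin_induction with
  | mem f hf =>
    obtain ⟨φ, rfl⟩ := hf
    exact ⟨φ, fun c v _ h => h φ⟩
  | algebraMap r => exact ⟨0, fun c v _ _ => hasDerivAt_const 0 r⟩
  | add f g _ _ hf hg =>
    obtain ⟨D, hD⟩ := hf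
    obtain ⟨E, hE⟩ := hg
    exact ⟨D + E, fun c v h0 h => (hD c v h0 h).add (hE c v h0 h)⟩
  | mul f g _ _ hf hg =>
    obtain ⟨D, hD⟩ := hf
    obtain ⟨E, hE⟩ := hg
    refine ⟨g x • D + f x • E, fun c v h0 h => ?_⟩
    refine ((hD c v h0 h).mul (hE c v h0 h)).congr_deriv ?_
    simp [h0, mul_comm]

theorem exists_isGradientAt_of_mem_polynomialAlgebra [Module.Finite ℝ M]
    {B : LinearMap.BilinForm ℝ M} (hB : B.Nondegenerate) {f : M → ℝ}
    (hf : f ∈ polynomialAlgebra M) (x : M) : ∃ η, IsGradientAt B f x η := by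
  obtain ⟨D, hD⟩ := exists_differential_of_mem_polynomialAlgebra hf x
  refine ⟨(B.toDual hB).symm D, fun w => ?_⟩
  rw [LinearMap.BilinForm.apply_toDual_symm_apply]
  exact hD _ w (by simp) (hasVelocity_line x w)

/-- The derivative of a polynomial function along a curve, in terms of its gradient. -/
theorem IsGradientAt.hasDerivAt {B : LinearMap.BilinForm ℝ M} {f : M → ℝ} {x η : M}
    (h : IsGradientAt B f x η) (hf : f ∈ polynomialAlgebra M) {c : ℝ → M} {v : M} (h0 : c 0 = x)
    (hc : HasVelocity c v) : HasDerivAt (fun t => f (c t)) (B η v) 0 := by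
  obtain ⟨D, hD⟩ := exists_differential_of_mem_polynomialAlgebra hf x
  have h1 : B η v = D v := (h v).unique (hD _ v (by simp) (hasVelocity_line x v))
  rw [h1]
  exact hD c v h0 hc

end WeakDeriv

/-! ### Polynomial maps and first variations of iterated brackets -/

section PolynomialMaps

variable {V : Type*} [AddCommGroup V] [Module ℝ V]

theorem dual_mem_polynomialAlgebra (φ : Module.Dual ℝ V) :
    (fun x => φ x) ∈ polynomialAlgebra V :=
  Algebra.subset_adjoin ⟨φ, rfl⟩

theorem bilin_mem_polynomialAlgebra {M N : Type*} [AddCommGroup M] [Module ℝ M] [AddCommGroup N]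
    [Module ℝ N] [Module.Finite ℝ M] [Module.Finite ℝ N] {f : V → M} {g : V → N}
    (hf : ∀ φ : Module.Dual ℝ M, (fun x => φ (f x)) ∈ polynomialAlgebra V)
    (hg : ∀ φ : Module.Dual ℝ N, (fun x => φ (g x)) ∈ polynomialAlgebra V)
    (B : M →ₗ[ℝ] N →ₗ[ℝ] ℝ) : (fun x => B (f x) (g x)) ∈ polynomialAlgebra V := by
  let a := Module.finBasis ℝ M
  let b := Module.finBasis ℝ N
  have key : (fun x => B (f x) (g x)) = ∑ i, ∑ j, B (a i) (b j) •
      ((fun x => a.coord i (f x)) * fun x => b.coord j (g x)) := by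
    ext x
    conv_lhs => rw [← a.sum_repr (f x), ← b.sum_repr (g x)]
    simp only [map_sum, map_smul, LinearMap.sum_apply, LinearMap.smul_apply, smul_eq_mul,
      Module.Basis.coord_apply, Finset.mul_sum, Finset.sum_apply, Pi.smul_apply, Pi.mul_apply]
    rw [Finset.sum_comm]
    exact Finset.sum_congr rfl fun i _ => Finset.sum_congr rfl fun j _ => by ring
  rw [key]
  exact sum_mem fun i _ => sum_mem fun j _ =>
    Subalgebra.smul_mem _ (mul_mem (hf _) (hg _)) _

theorem mvPolynomial_eval_mem_polynomialAlgebra {ι : Type*} (p : MvPolynomial ι ℝ)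
    {g : ι → V → ℝ} (hg : ∀ i, g i ∈ polynomialAlgebra V) :
    (fun x => MvPolynomial.eval (fun i => g i x) p) ∈ polynomialAlgebra V := by
  induction p using MvPolynomial.induction_on with
  | C r =>
    simp only [MvPolynomial.eval_C]
    exact Subalgebra.algebraMap_mem (polynomialAlgebra V) r
  | add p q hp hq => simpa using! add_mem hp hq
  | mul_X p i hp => simpa using! mul_mem hp (hg i)

variable {κ L : Type*} [LieRing L] [LieAlgebra ℝ L] [Module.Finite ℝ L]

variable (L) in
/-- The bracket as a bilinear map. -/
def lieBilin : L →ₗ[ℝ] L →ₗ[ℝ] L :=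
  LinearMap.mk₂ ℝ (fun u v => ⁅u, v⁆) add_lie smul_lie lie_add (fun c u v => lie_smul c u v)

theorem lieWord_mem_polynomialAlgebra (x : κ → V →ₗ[ℝ] L) (w : FreeMagma κ)
    (φ : Module.Dual ℝ L) :
    (fun v => φ (lieWord (fun i => x i v) w)) ∈ polynomialAlgebra V := by
  induction w generalizing φ with
  | ih1 i => exact dual_mem_polynomialAlgebra (φ ∘ₗ x i)
  | ih2 a b ha hb =>
    exact bilin_mem_polynomialAlgebra ha hb ((lieBilin L).compr₂ φ)

theorem det_lieWord_mem_polynomialAlgebra {m : ℕ} (b : Module.Basis (Fin m) ℝ L)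
    (x : κ → V →ₗ[ℝ] L) (W : Fin m → FreeMagma κ) :
    (fun v => b.det fun j => lieWord (fun i => x i v) (W j)) ∈ polynomialAlgebra V := by
  have key : (fun v => b.det fun j => lieWord (fun i => x i v) (W j)) =
      ∑ σ : Equiv.Perm (Fin m), (σ.sign : ℤ) •
        ∏ j, fun v => b.coord (σ j) (lieWord (fun i => x i v) (W j)) := by
    ext v
    simp [Module.Basis.det_apply, Matrix.det_apply, Module.Basis.toMatrix_apply, Finset.sum_apply,
      Finset.prod_apply, Units.smul_def]
  rw [key]
  exact sum_mem fun σ _ => zsmul_mem (prod_mem fun j _ => lieWord_mem_polynomialAlgebra _ _ _) _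

/-- The derivative at `x`, in the direction `y`, of an iterated bracket. -/
def lieWordDeriv (x y : κ → L) : FreeMagma κ → L
  | .of i => y i
  | .mul a b => ⁅lieWordDeriv x y a, lieWord x b⁆ + ⁅lieWord x a, lieWordDeriv x y b⁆

theorem hasVelocity_lieWord (x y : κ → L) (w : FreeMagma κ) :
    HasVelocity (fun t : ℝ => lieWord (fun i => x i + t • y i) w) (lieWordDeriv x y w) := by
  induction w with
  | ih1 i => exact hasVelocity_line (x i) (y i)
  | ih2 a b ha hb =>
    have h := ha.bilin hb (lieBilin L)
    simpa using! h

/-- If the variation `y` of a generating family `x` preserves to first order the Killing products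
of all iterated brackets, then it is the restriction of an inner derivation. -/
theorem exists_eq_lie_of_killingForm_lieWordDeriv [LieAlgebra.IsKilling ℝ L] {x y : κ → L}
    (hx : LieSubalgebra.lieSpan ℝ L (Set.range x) = ⊤)
    (h : ∀ a b : FreeMagma κ, killingForm ℝ L (lieWordDeriv x y a) (lieWord x b) +
      killingForm ℝ L (lieWord x a) (lieWordDeriv x y b) = 0) :
    ∃ ξ : L, ∀ i, y i = ⁅ξ, x i⁆ := by
  have hspan : Submodule.span ℝ (Set.range (lieWord x)) = ⊤ := by
    rw [span_range_lieWord, hx, LieSubalgebra.top_toSubmodule]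
  -- Formal combinations of words, with their value `ev` and first variation `dv`; the aim is to
  -- push `dv` down through `ev`.
  let ev := Finsupp.linearCombination ℝ (lieWord x)
  let dv := Finsupp.linearCombination ℝ (lieWordDeriv x y)
  have hev : Function.Surjective ev := by
    rw [← LinearMap.range_eq_top, Finsupp.range_linearCombination, hspan]
  have hadj : ∀ p b, killingForm ℝ L (dv p) (lieWord x b) +
      killingForm ℝ L (ev p) (lieWordDeriv x y b) = 0 := by
    intro p b
    induction p using Finsupp.induction_linear with
    | zero => simp
    | add p q hp hq =>
      simp only [map_add, LinearMap.add_apply] at hp hq ⊢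
      linear_combination hp + hq
    | single a r =>
      have := h a b
      simp only [ev, dv, Finsupp.linearCombination_single, map_smul, LinearMap.smul_apply,
        smul_eq_mul]
      linear_combination r * this
  -- If `ev p = 0`, then `hadj` makes `dv p` Killing-orthogonal to all words, which span `L`.
  have hker : ∀ p, ev p = 0 → dv p = 0 := by
    intro p hp
    have h1 : ∀ z, killingForm ℝ L (dv p) z = 0 := by
      intro z
      have hz : z ∈ Submodule.span ℝ (Set.range (lieWord x)) := by rw [hspan]; trivial
      induction hz using Submodule.span_induction with
      | mem z hz =>
        obtain ⟨b, rfl⟩ := hz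
        simpa [hp] using hadj p b
      | zero => simp
      | add u v _ _ hu hv => rw [map_add, hu, hv, add_zero]
      | smul r u _ hu => rw [map_smul, hu, smul_zero]
    exact (LieAlgebra.IsKilling.killingForm_nondegenerate ℝ L).1 _ h1
  obtain ⟨s, hs⟩ := ev.exists_rightInverse_of_surjective (LinearMap.range_eq_top.2 hev)
  -- By `hker` the choice of the section `s` does not matter.
  let D : L →ₗ[ℝ] L := dv ∘ₗ s
  have hD : ∀ a, D (lieWord x a) = lieWordDeriv x y a := by
    intro a
    have h1 : ev (s (lieWord x a) - Finsupp.single a 1) = 0 := by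
      rw [map_sub, sub_eq_zero]
      have := LinearMap.congr_fun hs (lieWord x a)
      simpa [ev] using! this
    have h2 := hker _ h1
    rw [map_sub, sub_eq_zero] at h2
    simpa [dv] using! h2
  have hleib : ∀ u v : L, D ⁅u, v⁆ = ⁅D u, v⁆ + ⁅u, D v⁆ := by
    intro u v
    have hu : u ∈ Submodule.span ℝ (Set.range (lieWord x)) := by rw [hspan]; trivial
    have hv : v ∈ Submodule.span ℝ (Set.range (lieWord x)) := by rw [hspan]; trivial
    induction hu, hv using Submodule.span_induction₂ with
    | mem_mem u v hu hv =>
      obtain ⟨a, rfl⟩ := hu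
      obtain ⟨b, rfl⟩ := hv
      rw [hD, hD]
      exact hD (.mul a b)
    | zero_left v _ => simp
    | zero_right u _ => simp
    | add_left u v w _ _ _ h1 h2 => simp only [add_lie, map_add, h1, h2]; abel
    | add_right u v w _ _ _ h1 h2 => simp only [lie_add, map_add, h1, h2]; abel
    | smul_left r u v _ _ h => simp only [smul_lie, map_smul, h, smul_add]
    | smul_right r u v _ _ h => simp only [lie_smul, map_smul, h, smul_add]
  let 𝒟 : LieDerivation ℝ L L :=
    { toLinearMap := D
      leibniz' := fun u v => by rw [hleib, ← lie_skew v (D u)]; abel }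
  obtain ⟨ξ, hξ⟩ := LieDerivation.IsKilling.exists_eq_ad 𝒟
  refine ⟨ξ, fun i => ?_⟩
  have h1 : D (x i) = y i := hD (.of i)
  have h2 : 𝒟 (x i) = y i := h1
  rw [← h2, ← hξ]
  simp

end PolynomialMaps

/-! ### Regular elements and the kernel of the bivector -/

section Regular

open LieAlgebra LieSubalgebra in
/-- The centralizer of a regular element of a Lie algebra with nondegenerate Killing form has the
dimension of the rank. -/
theorem finrank_ker_ad_of_isRegular {F L : Type*} [Field F] [Infinite F] [LieRing L]
    [LieAlgebra F L] [FiniteDimensional F L] [IsKilling F L] {x : L} (hx : IsRegular F x) :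
    Module.finrank F (LinearMap.ker (ad F L x)) = rank F L := by
  have hcard : (Module.finrank F L : Cardinal) ≤ Cardinal.mk F :=
    Cardinal.natCast_le_aleph0.trans (Cardinal.infinite_iff.mp ‹Infinite F›)
  have hC : IsCartanSubalgebra (engel F x) := by
    refine ⟨?_, normalizer_engel _ _⟩
    apply isNilpotent_of_forall_le_engel
    intro y hy
    set Ex : {engel F z | z ∈ engel F x} := ⟨engel F x, x, self_mem_engel _ _, rfl⟩
    suffices IsBot Ex from @this ⟨engel F y, y, hy, rfl⟩
    -- An Engel subalgebra inside that of `x` cannot be smaller, as regularity gives the latter the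
    -- least possible dimension.
    apply engel_isBot_of_isMin hcard (engel F x) Ex le_rfl
    rintro ⟨_, y, hy, rfl⟩ hyx
    suffices Module.finrank F (engel F x) ≤ Module.finrank F (engel F y) by
      suffices engel F y = engel F x from this.ge
      apply LieSubalgebra.toSubmodule_injective
      exact Submodule.eq_of_le_of_finrank_le hyx this
    rw [(isRegular_iff_finrank_engel_eq_rank F x).mp hx]
    apply rank_le_finrank_engel
  rw [← (isRegular_iff_finrank_engel_eq_rank F x).mp hx]
  have hker : LinearMap.ker (ad F L x) = (engel F x).toSubmodule := by
    ext y
    rw [LinearMap.mem_ker, mem_toSubmodule]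
    constructor
    · intro hy
      rw [mem_engel_iff]
      exact ⟨1, by simpa using hy⟩
    · intro hy
      -- Cartan subalgebras are abelian here, so all of `engel F x` commutes with `x`, not just
      -- nilpotently.
      have h := trivial_lie_zero (engel F x) (engel F x) ⟨x, self_mem_engel F x⟩ ⟨y, hy⟩
      exact congrArg Subtype.val h
  rw [hker]
  rfl

/-- In coordinates, the regular elements are those where some polynomial does not vanish. -/
theorem exists_mvPolynomial_isRegular_iff {F L ι : Type*} [Field F] [LieRing L] [LieAlgebra F L]
    [Module.Finite F L] [Fintype ι] [DecidableEq ι] (b : Module.Basis ι F L) :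
    ∃ p : MvPolynomial ι F, ∀ v : L,
      LieAlgebra.IsRegular F v ↔ MvPolynomial.eval (b.repr v) p ≠ 0 :=
  ⟨_, fun v => LieAlgebra.isRegular_iff_coeff_polyCharpoly_rank_ne_zero F b v⟩

end Regular

/-! ### Orbits, gradients and the kernel at a tuple -/

section Reduction

variable {n : ℕ} {L : Type*} [LieRing L] [LieAlgebra ℝ L]

theorem vForm_apply (x y : vSpace n L) :
    vForm n L x y = ∑ i, -killingForm ℝ L (x.1 i) (y.1 i) := rfl

/-- Invariance of the Killing form. The bivector thus pairs `ζ` with the tuple `([xᵢ, ηᵢ])`. -/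
theorem vBivector_apply (x η ζ : vSpace n L) :
    vBivector n L x η ζ = ∑ i, killingForm ℝ L ⁅x.1 i, η.1 i⁆ (ζ.1 i) := by
  change -∑ i, -killingForm ℝ L (x.1 i) ⁅η.1 i, ζ.1 i⁆ = _
  simp only [Finset.sum_neg_distrib, neg_neg]
  exact Finset.sum_congr rfl fun i _ => (LieModule.traceForm_apply_lie_apply ℝ L L _ _ _).symm

variable (n) in
/-- The element of `𝔳` with `u` at the place `i` and `-u` at the place `j`. -/
def vPair (i j : Fin n) (u : L) : vSpace n L :=
  ⟨Pi.single i u - Pi.single j u, by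
    change ∑ k, (Pi.single i u - Pi.single j u : Fin n → L) k = 0
    simp⟩

/-- The infinitesimal action `ξ ↦ ([ξ, x₁], …, [ξ, xₙ])` of the diagonal on `𝔳`. -/
def orbitMap (x : vSpace n L) : L →ₗ[ℝ] vSpace n L where
  toFun ξ := ⟨fun i => ⁅ξ, x.1 i⁆, by
    have h : ∑ i, x.1 i = 0 := x.2
    change ∑ i, ⁅ξ, x.1 i⁆ = 0
    rw [← lie_sum, h, lie_zero]⟩
  map_add' a b := by ext i; simp
  map_smul' c a := by ext i; simp

theorem orbitMap_apply (x : vSpace n L) (ξ : L) (i : Fin n) : (orbitMap x ξ).1 i = ⁅ξ, x.1 i⁆ :=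
  rfl

theorem vForm_isSymm : (vForm n L).IsSymm :=
  ⟨fun x y => by
    simp only [vForm_apply]
    exact Finset.sum_congr rfl fun i _ => congrArg _ (LieModule.traceForm_comm ℝ L L _ _)⟩

theorem vForm_orbitMap (x η : vSpace n L) (ξ : L) :
    vForm n L (orbitMap x ξ) η = -killingForm ℝ L ξ (∑ i, ⁅x.1 i, η.1 i⁆) := by
  rw [vForm_apply, map_sum, ← Finset.sum_neg_distrib]
  refine Finset.sum_congr rfl fun i _ => ?_
  rw [orbitMap_apply, LieModule.traceForm_apply_lie_apply]

theorem eq_zero_of_forall_killingForm_eq_zero [LieAlgebra.IsKilling ℝ L] {u : L}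
    (h : ∀ v, killingForm ℝ L u v = 0) :
    u = 0 :=
  (LieAlgebra.IsKilling.killingForm_nondegenerate ℝ L).1 u h

/-- Testing `x` against `vPair n i j u` forces all entries to be equal; since they sum to zero, they
vanish. -/
theorem vForm_nondegenerate [LieAlgebra.IsKilling ℝ L] [NeZero n] : (vForm n L).Nondegenerate := by
  have hrefl : LinearMap.IsRefl (vForm n L) := vForm_isSymm.isRefl
  refine hrefl.nondegenerate_iff_separatingLeft.2 fun x hx => ?_
  have h1 : ∀ i j, x.1 i = x.1 j := by
    intro i j
    rw [← sub_eq_zero]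
    apply eq_zero_of_forall_killingForm_eq_zero
    intro u
    have h := hx (vPair n i j u)
    rw [vForm_apply] at h
    simp only [vPair, Pi.sub_apply, map_sub, Finset.sum_neg_distrib, Finset.sum_sub_distrib,
      Pi.apply_single (fun k => killingForm ℝ L (x.1 k)) (fun k => map_zero _),
      Finset.sum_pi_single', Finset.mem_univ, if_true] at h
    rw [map_sub, LinearMap.sub_apply]
    linear_combination -h
  ext i
  have h2 : ∑ j, x.1 j = 0 := x.2
  rw [Finset.sum_congr rfl fun j _ => h1 j i] at h2
  simpa [← Nat.cast_smul_eq_nsmul ℝ, NeZero.ne n] using h2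

theorem mem_orthogonal_range_orbitMap_iff [LieAlgebra.IsKilling ℝ L] {x η : vSpace n L} :
    η ∈ (vForm n L).orthogonal (LinearMap.range (orbitMap x)) ↔ ∑ i, ⁅x.1 i, η.1 i⁆ = 0 := by
  rw [LinearMap.BilinForm.mem_orthogonal_iff]
  constructor
  · intro h
    apply eq_zero_of_forall_killingForm_eq_zero
    intro ξ
    have := h _ ⟨ξ, rfl⟩
    rw [vForm_orbitMap] at this
    rw [LieModule.traceForm_comm]
    linarith
  · rintro h _ ⟨ξ, rfl⟩
    rw [vForm_orbitMap, h, map_zero, neg_zero]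

/-- The tuple `(c₁ - s, …, cₙ - s)`, where `s` is the mean of the `cᵢ`, for `cᵢ` in the centralizer
of `xᵢ`. -/
def centralizerMap [NeZero n] (x : vSpace n L) :
    (∀ i, LinearMap.ker (LieAlgebra.ad ℝ L (x.1 i))) →ₗ[ℝ] vSpace n L where
  toFun c := ⟨fun i => (c i : L) - (n : ℝ)⁻¹ • ∑ j, (c j : L), by
    change ∑ i, ((c i : L) - (n : ℝ)⁻¹ • ∑ j, (c j : L)) = 0
    rw [Finset.sum_sub_distrib, Finset.sum_const, Finset.card_univ, Fintype.card_fin,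
      ← Nat.cast_smul_eq_nsmul ℝ, smul_smul, mul_inv_cancel₀ (by simp [NeZero.ne n]), one_smul,
      sub_self]⟩
  map_add' a b := by
    ext i
    simp only [Pi.add_apply, Submodule.coe_add, Finset.sum_add_distrib, smul_add]
    abel
  map_smul' r a := by
    ext i
    simp only [Pi.smul_apply, Submodule.coe_smul, ← Finset.smul_sum, smul_sub, RingHom.id_apply]
    rw [smul_comm]

theorem centralizerMap_apply [NeZero n] (x : vSpace n L)
    (c : ∀ i, LinearMap.ker (LieAlgebra.ad ℝ L (x.1 i))) (i : Fin n) :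
    (centralizerMap x c).1 i = (c i : L) - (n : ℝ)⁻¹ • ∑ j, (c j : L) := rfl

/-- Bracketing with `xᵢ` kills `cᵢ` and leaves only the common mean, so the tuple of brackets is
tangent to the orbit. -/
theorem lie_centralizerMap [NeZero n] (x : vSpace n L)
    (c : ∀ i, LinearMap.ker (LieAlgebra.ad ℝ L (x.1 i))) (i : Fin n) :
    ⁅x.1 i, (centralizerMap x c).1 i⁆ = (orbitMap x ((n : ℝ)⁻¹ • ∑ j, (c j : L))).1 i := by
  have h : ⁅x.1 i, (c i : L)⁆ = 0 := (c i).2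
  rw [centralizerMap_apply, orbitMap_apply, lie_sub, h, zero_sub, lie_skew]

variable [Module.Finite ℝ L]

variable (n L) in
theorem finrank_vSpace [NeZero n] :
    Module.finrank ℝ (vSpace n L) = (n - 1) * Module.finrank ℝ L := by
  let s : (Fin n → L) →ₗ[ℝ] L := ∑ i, LinearMap.proj i
  have hs : ∀ x, s x = ∑ i, x i := fun x => by simp [s]
  have hsurj : Function.Surjective s := fun u => ⟨Pi.single 0 u, by simp [hs]⟩
  have hker : LinearMap.ker s = vSpace n L := by
    ext x
    rw [LinearMap.mem_ker, hs]
    rfl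
  have h := s.finrank_range_add_finrank_ker
  rw [LinearMap.range_eq_top.2 hsurj, finrank_top, hker, Module.finrank_pi_fintype] at h
  simp only [Finset.sum_const, Finset.card_univ, Fintype.card_fin, smul_eq_mul] at h
  rw [Nat.sub_mul, one_mul]
  omega

variable [LieAlgebra.IsKilling ℝ L]

/-- The centralizer of `ξ` is a subalgebra, so it is everything; and the centre is zero. -/
theorem eq_zero_of_forall_lie_eq_zero {κ : Type*} {x : κ → L}
    (hx : LieSubalgebra.lieSpan ℝ L (Set.range x) = ⊤) {ξ : L} (h : ∀ i, ⁅ξ, x i⁆ = 0) :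
    ξ = 0 := by
  have hξ : ξ ∈ LieAlgebra.center ℝ L := by
    rw [LieModule.mem_maxTrivSubmodule]
    intro u
    have hu : u ∈ LieSubalgebra.lieSpan ℝ L (Set.range x) := by rw [hx]; trivial
    rw [← lie_skew, neg_eq_zero]
    induction hu using LieSubalgebra.lieSpan_induction with
    | mem u hu => obtain ⟨i, rfl⟩ := hu; exact h i
    | zero => exact lie_zero ξ
    | add u v _ _ hu hv => rw [lie_add, hu, hv, add_zero]
    | smul r u _ hu => rw [lie_smul, hu, smul_zero]
    | lie u v _ _ hu hv => rw [leibniz_lie, hu, hv, zero_lie, lie_zero, add_zero]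
  rwa [LieAlgebra.center_eq_bot, LieSubmodule.mem_bot] at hξ

/-- At a generating tuple, the gradients of the invariants span the orthogonal complement of the
tangent space of the orbit. -/
theorem gradientSpan_eq_orthogonal [NeZero n] {F : Set (vSpace n L → ℝ)}
    (hpoly : ∀ f ∈ F, f ∈ polynomialAlgebra (vSpace n L))
    (hinv : ∀ f ∈ F, ∀ x η, IsGradientAt (vForm n L) f x η →
      ∀ ξ, vForm n L η (orbitMap x ξ) = 0)
    (hword : ∀ a b, (fun x : vSpace n L => killingForm ℝ L (lieWord x.1 a) (lieWord x.1 b)) ∈ F)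
    {x : vSpace n L} (hx : LieSubalgebra.lieSpan ℝ L (Set.range x.1) = ⊤) :
    gradientSpan (vForm n L) F x =
      (vForm n L).orthogonal (LinearMap.range (orbitMap x)) := by
  have hnd := vForm_nondegenerate (n := n) (L := L)
  have hrefl := (vForm_isSymm (n := n) (L := L)).isRefl
  apply le_antisymm
  · rw [gradientSpan, Submodule.span_le]
    rintro η ⟨f, hf, hη⟩
    rw [SetLike.mem_coe, LinearMap.BilinForm.mem_orthogonal_iff]
    rintro _ ⟨ξ, rfl⟩
    exact hrefl _ _ (hinv f hf x η hη ξ)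
  -- By double orthogonality it is enough that every `y` orthogonal to the gradients is tangent to
  -- the orbit.
  · rw [← LinearMap.BilinForm.orthogonal_orthogonal hnd hrefl (gradientSpan (vForm n L) F x)]
    apply LinearMap.BilinForm.orthogonal_le
    intro y hy
    rw [LinearMap.BilinForm.mem_orthogonal_iff] at hy
    obtain ⟨ξ, hξ⟩ := exists_eq_lie_of_killingForm_lieWordDeriv (y := y.1) hx (by
      intro a b
      obtain ⟨η, hη⟩ := exists_isGradientAt_of_mem_polynomialAlgebra hnd (hpoly _ (hword a b)) x
      have h0 : vForm n L η y = 0 := hy η (Submodule.subset_span ⟨_, hword a b, hη⟩)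
      have h1 := hη y
      rw [h0] at h1
      have h2 := ((hasVelocity_lieWord x.1 y.1 a).bilin (hasVelocity_lieWord x.1 y.1 b)
        (killingForm ℝ L)).hasDerivAt
      have h3 := h2.unique h1
      simpa using h3)
    exact ⟨ξ, by ext i; exact (hξ i).symm⟩

theorem orbitMap_injective {x : vSpace n L}
    (hx : LieSubalgebra.lieSpan ℝ L (Set.range x.1) = ⊤) : Function.Injective (orbitMap x) := by
  rw [← LinearMap.ker_eq_bot, LinearMap.ker_eq_bot']
  intro ξ hξ
  exact eq_zero_of_forall_lie_eq_zero hx fun i => congrFun (congrArg Subtype.val hξ) i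

theorem finrank_orthogonal_range_orbitMap [NeZero n] {x : vSpace n L}
    (hx : LieSubalgebra.lieSpan ℝ L (Set.range x.1) = ⊤) :
    Module.finrank ℝ ((vForm n L).orthogonal (LinearMap.range (orbitMap x))) =
      (n - 2) * Module.finrank ℝ L := by
  rw [LinearMap.BilinForm.finrank_orthogonal vForm_nondegenerate,
    LinearMap.finrank_range_of_inj (orbitMap_injective hx), finrank_vSpace, ← Nat.sub_one_mul]
  rfl

/-- On the kernel all `cᵢ` equal their mean, which then commutes with every `xᵢ`. -/
theorem centralizerMap_injective [NeZero n] {x : vSpace n L}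
    (hx : LieSubalgebra.lieSpan ℝ L (Set.range x.1) = ⊤) :
    Function.Injective (centralizerMap x) := by
  rw [← LinearMap.ker_eq_bot, LinearMap.ker_eq_bot']
  intro c hc
  have h1 : ∀ i, (c i : L) = (n : ℝ)⁻¹ • ∑ j, (c j : L) := fun i =>
    sub_eq_zero.1 (congrFun (congrArg Subtype.val hc) i)
  have h2 : (n : ℝ)⁻¹ • ∑ j, (c j : L) = 0 := by
    refine eq_zero_of_forall_lie_eq_zero hx fun i => ?_
    rw [← h1 i, ← lie_skew, neg_eq_zero]
    exact (c i).2
  ext i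
  rw [h1 i, h2]
  rfl

/-- The kernel of the restricted bivector at `x` consists of the tuples `(cᵢ - s)`, with `cᵢ` in the
centralizer of `xᵢ` and `s` the mean of the `cᵢ`. -/
theorem map_ker_restrict_vBivector [NeZero n] (x : vSpace n L) :
    (LinearMap.ker ((vBivector n L x).restrict
      ((vForm n L).orthogonal (LinearMap.range (orbitMap x))))).map
        ((vForm n L).orthogonal (LinearMap.range (orbitMap x))).subtype =
      LinearMap.range (centralizerMap x) := by
  have hnd := vForm_nondegenerate (n := n) (L := L)
  have hrefl := (vForm_isSymm (n := n) (L := L)).isRefl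
  ext η
  rw [Submodule.mem_map]
  constructor
  · rintro ⟨⟨η, hη⟩, hker, rfl⟩
    have hsum := mem_orthogonal_range_orbitMap_iff.1 hη
    -- Orthogonality of `η` to the orbit puts `θ` in `𝔳`; the kernel condition makes `θ` orthogonal
    -- to everything orthogonal to the orbit, so `θ` is tangent to it.
    let θ : vSpace n L := ⟨fun i => ⁅x.1 i, η.1 i⁆, hsum⟩
    have hθ : θ ∈ LinearMap.range (orbitMap x) := by
      rw [← LinearMap.BilinForm.orthogonal_orthogonal hnd hrefl (LinearMap.range (orbitMap x)),
        LinearMap.BilinForm.mem_orthogonal_iff]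
      intro ζ hζ
      apply hrefl
      have h1 : vBivector n L x η ζ = 0 :=
        LinearMap.congr_fun (LinearMap.mem_ker.1 hker) ⟨ζ, hζ⟩
      rw [vBivector_apply] at h1
      rw [vForm_apply, Finset.sum_neg_distrib, neg_eq_zero]
      exact h1
    obtain ⟨ξ, hξ⟩ := hθ
    have hc : ∀ i, η.1 i + ξ ∈ LinearMap.ker (LieAlgebra.ad ℝ L (x.1 i)) := by
      intro i
      have h1 : ⁅ξ, x.1 i⁆ = ⁅x.1 i, η.1 i⁆ := congrFun (congrArg Subtype.val hξ) i
      rw [LinearMap.mem_ker, LieAlgebra.ad_apply, lie_add, ← h1, ← lie_skew (x.1 i) ξ,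
        add_neg_cancel]
    -- The preimage is `cᵢ = ηᵢ + ξ`, whose mean is `ξ` because the `ηᵢ` sum to zero.
    refine ⟨fun i => ⟨_, hc i⟩, ?_⟩
    ext i
    have h2 : ∑ j, η.1 j = 0 := η.2
    rw [centralizerMap_apply]
    simp only [Finset.sum_add_distrib, h2, zero_add, Finset.sum_const, Finset.card_univ,
      Fintype.card_fin, ← Nat.cast_smul_eq_nsmul ℝ, smul_smul]
    rw [inv_mul_cancel₀ (by simp [NeZero.ne n]), one_smul, add_sub_cancel_right]
    rfl
  · rintro ⟨c, rfl⟩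
    have hlie := lie_centralizerMap x c
    have hmem : centralizerMap x c ∈
        (vForm n L).orthogonal (LinearMap.range (orbitMap x)) := by
      rw [mem_orthogonal_range_orbitMap_iff, Finset.sum_congr rfl fun i _ => hlie i]
      exact (orbitMap x _).2
    refine ⟨⟨_, hmem⟩, ?_, rfl⟩
    rw [LinearMap.mem_ker]
    ext ⟨ζ, hζ⟩
    change vBivector n L x (centralizerMap x c) ζ = 0
    have h1 : vForm n L (orbitMap x ((n : ℝ)⁻¹ • ∑ j, (c j : L))) ζ = 0 := hζ _ ⟨_, rfl⟩
    rw [vForm_apply, Finset.sum_neg_distrib, neg_eq_zero] at h1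
    rw [vBivector_apply, ← h1]
    exact Finset.sum_congr rfl fun i _ => by rw [hlie i]

theorem finrank_ker_restrict_vBivector [NeZero n] {x : vSpace n L}
    (hx : LieSubalgebra.lieSpan ℝ L (Set.range x.1) = ⊤)
    (hreg : ∀ i, LieAlgebra.IsRegular ℝ (x.1 i)) :
    Module.finrank ℝ (LinearMap.ker ((vBivector n L x).restrict
      ((vForm n L).orthogonal (LinearMap.range (orbitMap x))))) =
      n * LieAlgebra.rank ℝ L := by
  rw [← Submodule.finrank_map_subtype_eq, map_ker_restrict_vBivector,
    LinearMap.finrank_range_of_inj (centralizerMap_injective hx), Module.finrank_pi_fintype,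
    Finset.sum_congr rfl fun i _ => finrank_ker_ad_of_isRegular (hreg i)]
  simp

/-! ### Generic tuples in `𝔳` -/

section Generic

variable (n L) in
/-- The coordinate projection `𝔳 → 𝔨`. -/
def vProj (i : Fin n) : vSpace n L →ₗ[ℝ] L := LinearMap.proj i ∘ₗ (vSpace n L).subtype

variable (n L) in
/-- For `n ≥ 3`, some tuple in `𝔳` generates the Lie algebra. -/
theorem exists_vSpace_lieSpan_eq_top (hn : 3 ≤ n) :
    ∃ x : vSpace n L, LieSubalgebra.lieSpan ℝ L (Set.range x.1) = ⊤ := by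
  obtain ⟨u, hu⟩ := exists_lieSpan_pair_eq_top ℝ L
  let i : Fin 3 → Fin n := fun k => ⟨k, by omega⟩
  have h01 : i 0 ≠ i 1 := by simp [i]
  have h02 : i 0 ≠ i 2 := by simp [i]
  have h12 : i 1 ≠ i 2 := by simp [i]
  -- The tuple `(u₀, u₁, -u₀ - u₁, 0, …, 0)`: the third place absorbs the sum.
  refine ⟨vPair n (i 0) (i 2) (u 0) + vPair n (i 1) (i 2) (u 1), ?_⟩
  rw [eq_top_iff, ← hu, LieSubalgebra.lieSpan_le]
  rintro _ ⟨k, rfl⟩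
  apply LieSubalgebra.subset_lieSpan
  fin_cases k
  · exact ⟨i 0, by simp [vPair, h01, h02]⟩
  · exact ⟨i 1, by simp [vPair, h01.symm, h12]⟩

variable (n L) in
/-- Outside the zero set of a nonzero polynomial function, a tuple in `𝔳` generates the Lie algebra
and has regular entries. -/
theorem exists_polynomial_generic (hn : 3 ≤ n) :
    ∃ g ∈ polynomialAlgebra (vSpace n L), g ≠ 0 ∧ ∀ x : vSpace n L, g x ≠ 0 →
      LieSubalgebra.lieSpan ℝ L (Set.range x.1) = ⊤ ∧ ∀ i, LieAlgebra.IsRegular ℝ (x.1 i) := by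
  classical
  let b := Module.finBasis ℝ L
  obtain ⟨x₀, hx₀⟩ := exists_vSpace_lieSpan_eq_top n L hn
  obtain ⟨W, hW⟩ := (lieSpan_eq_top_iff_exists_det b x₀.1).1 hx₀
  obtain ⟨u, hu⟩ := LieAlgebra.exists_isRegular ℝ L
  let g₀ : vSpace n L → ℝ := fun x => b.det fun j => lieWord x.1 (W j)
  obtain ⟨p, hp⟩ := exists_mvPolynomial_isRegular_iff b
  let g : Fin n → vSpace n L → ℝ := fun i x => MvPolynomial.eval (b.repr (x.1 i)) p
  have hg₀ : g₀ ∈ polynomialAlgebra (vSpace n L) :=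
    det_lieWord_mem_polynomialAlgebra b (vProj n L) W
  have hg : ∀ i, g i ∈ polynomialAlgebra (vSpace n L) := fun i =>
    mvPolynomial_eval_mem_polynomialAlgebra p fun j =>
      dual_mem_polynomialAlgebra (b.coord j ∘ₗ vProj n L i)
  have hg0 : ∀ i, g i ≠ 0 := by
    intro i h0
    -- A regular `u` at place `i`, balanced by `-u` at `j`, shows that the `i`-th regularity
    -- polynomial is not zero on `𝔳`.
    obtain ⟨j, hj⟩ : ∃ j : Fin n, j ≠ i := by
      have : Nontrivial (Fin n) := Fin.nontrivial_iff_two_le.2 (by omega)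
      exact exists_ne i
    refine (hp u).1 hu ?_
    have := congrFun h0 (vPair n i j u)
    simpa [g, vPair, hj.symm] using this
  refine ⟨g₀ * ∏ i, g i, mul_mem hg₀ (prod_mem fun i _ => hg i), ?_, fun x hx => ?_⟩
  · refine mul_ne_zero_of_mem_polynomialAlgebra hg₀ (prod_mem fun i _ => hg i)
      (fun h0 => hW (congrFun h0 x₀)) ?_
    exact prod_ne_zero_of_mem_polynomialAlgebra _ (fun i _ => hg i) fun i _ => hg0 i
  · rw [Pi.mul_apply, Finset.prod_apply] at hx
    refine ⟨(lieSpan_eq_top_iff_exists_det b x.1).2 ⟨W, left_ne_zero_of_mul hx⟩, fun i => ?_⟩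
    exact (hp _).2 (Finset.prod_ne_zero_iff.1 (right_ne_zero_of_mul hx) i (Finset.mem_univ i))

end Generic

end Reduction

/-! ### Invariant polynomials and the adjoint action -/

section Invariants

variable {d : ℕ} {K : Type*} [TopologicalSpace K]
  [ChartedSpace (EuclideanSpace ℝ (Fin d)) K] [Group K] [LieGroup (𝓡 d) ∞ K] {n : ℕ}

theorem lieWord_Ad {κ : Type*} (k : K) (x : κ → GroupLieAlgebra (𝓡 d) K) (w : FreeMagma κ) :
    lieWord (fun i => Ad k (x i)) w = Ad k (lieWord x w) := by
  induction w with
  | ih1 i => rfl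
  | ih2 a b ha hb =>
    change ⁅lieWord (fun i => Ad k (x i)) a, lieWord (fun i => Ad k (x i)) b⁆ = _
    rw [ha, hb, ← Ad_lie]
    rfl

/-- `Ad k` is a Lie algebra automorphism, so it commutes with iterated brackets and preserves the
Killing form. These invariants alone have enough gradients. -/
theorem killingForm_lieWord_mem_invariantPolynomials (a b : FreeMagma (Fin n)) :
    (fun x : vSpace n (GroupLieAlgebra (𝓡 d) K) =>
      killingForm ℝ (GroupLieAlgebra (𝓡 d) K) (lieWord x.1 a) (lieWord x.1 b)) ∈
      (invariantPolynomials d K n : Set _) := by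
  refine ⟨?_, fun k x => ?_⟩
  · exact bilin_mem_polynomialAlgebra
      (lieWord_mem_polynomialAlgebra (vProj n (GroupLieAlgebra (𝓡 d) K)) a)
      (lieWord_mem_polynomialAlgebra (vProj n (GroupLieAlgebra (𝓡 d) K)) b) _
  · change killingForm ℝ (GroupLieAlgebra (𝓡 d) K) (lieWord (fun i => Ad k (x.1 i)) a)
      (lieWord (fun i => Ad k (x.1 i)) b) = _
    rw [lieWord_Ad, lieWord_Ad]
    exact LieAlgebra.killingForm_of_equiv_apply (AdEquiv k) _ _

/-- The gradient of an invariant polynomial is orthogonal to the orbits. -/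
theorem vForm_gradient_orbitMap_eq_zero {f : vSpace n (GroupLieAlgebra (𝓡 d) K) → ℝ}
    (hf : f ∈ invariantPolynomials d K n) {x η : vSpace n (GroupLieAlgebra (𝓡 d) K)}
    (hη : IsGradientAt (vForm n (GroupLieAlgebra (𝓡 d) K)) f x η)
    (ξ : GroupLieAlgebra (𝓡 d) K) :
    vForm n (GroupLieAlgebra (𝓡 d) K) η (orbitMap x ξ) = 0 := by
  obtain ⟨γ, hγ0, hγ⟩ := exists_curve_hasDerivAt_Ad ξ
  have h0 : AdH n (γ 0) x = x := by
    ext1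
    ext1 i
    change Ad (γ 0) (x.1 i) = x.1 i
    rw [hγ0, Ad_one]
  have hvel : HasVelocity (fun t => AdH n (γ t) x) (orbitMap x ξ) := by
    intro φ
    -- Extending the functional from `𝔳` to `𝔨ⁿ` splits it into functionals of the separate entries.
    obtain ⟨ψ, hψ⟩ := LinearMap.exists_extend φ
    have key : ∀ y : vSpace n (GroupLieAlgebra (𝓡 d) K),
        φ y = ∑ i, (ψ ∘ₗ LinearMap.single ℝ _ i) (y.1 i) := by
      intro y
      rw [← hψ]
      change ψ y.1 = ∑ i, ψ (Pi.single i (y.1 i))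
      rw [← map_sum, Finset.univ_sum_single]
    simp only [key]
    exact HasDerivAt.fun_sum fun i _ =>
      hγ (x.1 i) (ψ ∘ₗ LinearMap.single ℝ (fun _ => GroupLieAlgebra (𝓡 d) K) i)
  have h1 := hη.hasDerivAt hf.1 h0 hvel
  have h2 : (fun t => f (AdH n (γ t) x)) = fun _ => f x := funext fun t => hf.2 _ _
  rw [h2] at h1
  exact h1.unique (hasDerivAt_const _ _)

end Invariants

end LedgerObata

end

theorem lemma1 (d : ℕ) (K : Type*) [TopologicalSpace K] [T2Space K]
    [ChartedSpace (EuclideanSpace ℝ (Fin d)) K] [Group K] [LieGroup (𝓡 d) ∞ K]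
    [CompactSpace K] [ConnectedSpace K]
    [LieAlgebra.IsSemisimple ℝ (GroupLieAlgebra (𝓡 d) K)]
    (n : ℕ) (hn : 3 ≤ n) :
    LedgerObata.HasDifferentialDimension
        (LedgerObata.vForm n (GroupLieAlgebra (𝓡 d) K))
        (LedgerObata.invariantPolynomials d K n : Set _)
        ((n - 2) * d) ∧
      LedgerObata.HasDifferentialIndex
        (LedgerObata.vForm n (GroupLieAlgebra (𝓡 d) K))
        (LedgerObata.vBivector n (GroupLieAlgebra (𝓡 d) K))
        (LedgerObata.invariantPolynomials d K n : Set _)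
        (n * LieAlgebra.rank ℝ (GroupLieAlgebra (𝓡 d) K)) := by
  have : NeZero n := ⟨by omega⟩
  -- Cartan's criterion: semisimplicity in characteristic zero makes the Killing form nondegenerate.
  have : LieAlgebra.IsKilling ℝ (GroupLieAlgebra (𝓡 d) K) := inferInstance
  obtain ⟨g, hg, hg0, hgen⟩ :=
    LedgerObata.exists_polynomial_generic n (GroupLieAlgebra (𝓡 d) K) hn
  have hspan : ∀ x, g x ≠ 0 → LedgerObata.gradientSpan
      (LedgerObata.vForm n (GroupLieAlgebra (𝓡 d) K))
      (LedgerObata.invariantPolynomials d K n : Set _) x =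
      (LedgerObata.vForm n (GroupLieAlgebra (𝓡 d) K)).orthogonal
        (LinearMap.range (LedgerObata.orbitMap x)) := fun x hx =>
    LedgerObata.gradientSpan_eq_orthogonal (fun f hf => hf.1)
      (fun f hf x η hη ξ => LedgerObata.vForm_gradient_orbitMap_eq_zero hf hη ξ)
      LedgerObata.killingForm_lieWord_mem_invariantPolynomials (hgen x hx).1
  have hd : Module.finrank ℝ (GroupLieAlgebra (𝓡 d) K) = d :=
    finrank_euclideanSpace_fin (𝕜 := ℝ) (n := d)
  refine ⟨LedgerObata.almostEverywhere_of_polynomial hg hg0 fun x hx => ?_,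
    LedgerObata.almostEverywhere_of_polynomial hg hg0 fun x hx => ?_⟩
  · rw [hspan x hx, LedgerObata.finrank_orthogonal_range_orbitMap (hgen x hx).1, hd]
  · rw [hspan x hx]
    exact LedgerObata.finrank_ker_restrict_vBivector (hgen x hx).1 (hgen x hx).2
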